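/- Let $(S,\mathfrak n)$ be a regular local ring and let $I$ be an ideal of $S$ of height $g$ such that the local ring $R=S/I$ is Cohen–Macaulay. Let \[ 0\to G_g\xrightarrow{\ \sigma\ }G_{g-1}\to\cdots\to G_1\to G_0=S\to 0 \] be a minimal free $S$-resolution of $R$, where $G_i=S^{b_i}$, so that the maps are matrices over $S$ with entries in $\mathfrak n$ (for $g=0$, $G_{-1}=0$ and $\sigma=0$). Put $p=b_g$, i.e. $G_g=S^p$, and $\varphi=\sigma^T\otimes R$, a matrix over $R$. A canonical module of $R$ is a finitely generated $R$-module $\omega$ such that, with $k$ the residue field of $R$, $\operatorname{Ext}^i_R(k,\omega)=0$ for $i\ne\dim R$ and $\operatorname{Ext}^i_R(k,\omega)\cong k$ for $i=\dim R$. The Auslander dual $D(\omega)$ formed from a finite free presentation $F_1\xrightarrow{\psi}F_0\to\omega\to0$ is $\operatorname{coker}(\psi^*\colon F_0^*\to F_1^*)$, where ${}^*=\operatorname{Hom}_R(-,R)$. For a matrix $A$, $I_r(A)$ is the ideal generated by its $r\times r$ minors, with $I_0(A)=R$; the unit ideal has height $\infty$. Then $R$ has a canonical module, and every canonical module $\omega_R$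 of $R$ satisfies the following. (1) $\omega_R\cong\operatorname{coker}(\varphi)=\operatorname{coker}(\sigma^T\otimes R)$; in particular, $\operatorname{coker}(\sigma^T\otimes R)$ is a canonical module of $R$. (2) $\varphi$ is the first map of a finite free presentation of $\omega_R$, and the Auslander dual formed from this presentation is $D(\omega_R)\cong\operatorname{coker}(\sigma\otimes R)$. (3) $\omega_R$ is isomorphic to an ideal of $R$ if and only if $\operatorname{ht} I_{p-1}(\varphi)\ge 1$ and $I_p(\varphi)=0$. -/

import Mathlib

open CategoryTheory IsLocalRing

universe u

/-- A Noetherian local ring is Cohen–Macaulay if its depth equals its Krull dimension, that is, if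
the maximal ideal contains a regular sequence of length `dim R` (the length of a regular sequence
in the maximal ideal never exceeds `dim R`). -/
def IsCohenMacaulayLocal (R : Type u) [CommRing R] [IsLocalRing R] : Prop :=
  IsNoetherianRing R ∧ ∃ rs : List R, (∀ r ∈ rs, r ∈ maximalIdeal R) ∧
    RingTheory.Sequence.IsRegular R rs ∧ (rs.length : WithBot ℕ∞) = ringKrullDim R

/-- A canonical module of a local ring `R` with residue field `k`: a finitely generated module `ω`
with `Ext^i_R(k, ω) = 0` for `i ≠ dim R` and `Ext^i_R(k, ω) ≅ k` for `i = dim R`. -/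
structure IsCanonicalModule (R : Type u) [CommRing R] [IsLocalRing R]
    (ω : Type u) [AddCommGroup ω] [Module R ω] : Prop where
  finite : Module.Finite R ω
  ext_eq_zero : ∀ i : ℕ, (i : WithBot ℕ∞) ≠ ringKrullDim R →
    Subsingleton (Abelian.Ext (ModuleCat.of R (ResidueField R)) (ModuleCat.of R ω) i)
  ext_dim : ∀ i : ℕ, (i : WithBot ℕ∞) = ringKrullDim R →
    Nonempty (Abelian.Ext (ModuleCat.of R (ResidueField R)) (ModuleCat.of R ω) i
      ≃ₗ[R] ResidueField R)

/-- A minimal free resolution `0 → G_g → ⋯ → G_1 → G_0 = S → 0` of `S ⧸ I` over a local ring `S`.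
Here `G_i = S ^ (rank i)`, and `d i` is the matrix of the map `G_{i+1} → G_i`. -/
structure MinimalFreeResolution {S : Type u} [CommRing S] [IsLocalRing S] (I : Ideal S)
    (g : ℕ) where
  rank : ℕ → ℕ
  d : ∀ i : ℕ, Matrix (Fin (rank i)) (Fin (rank (i + 1))) S
  augmentation : (Fin (rank 0) → S) →ₗ[S] S ⧸ I
  rank_zero : rank 0 = 1
  rank_eq_zero : ∀ i : ℕ, g < i → rank i = 0
  augmentation_surjective : Function.Surjective augmentation
  exact_zero : Function.Exact (d 0).mulVecLin augmentation
  exact_succ : ∀ i : ℕ, Function.Exact (d (i + 1)).mulVecLin (d i).mulVecLin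
  minimal : ∀ i j k, d i j k ∈ maximalIdeal S

namespace MinimalFreeResolution

variable {S : Type u} [CommRing S] [IsLocalRing S] {I : Ideal S} {g : ℕ}

/-- The rank of `G_{i-1}`, with the convention `G_{-1} = 0`. -/
def prevRank (G : MinimalFreeResolution I g) : ℕ → ℕ
  | 0 => 0
  | i + 1 => G.rank i

/-- The matrix of the map `G_i → G_{i-1}` of the resolution, with the convention `G_{-1} = 0`. -/
def diff (G : MinimalFreeResolution I g) :
    ∀ i : ℕ, Matrix (Fin (G.prevRank i)) (Fin (G.rank i)) S
  | 0 => 0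
  | i + 1 => G.d i

/-- The last map `σ : G_g → G_{g-1}` of the resolution. -/
def lastMap (G : MinimalFreeResolution I g) : Matrix (Fin (G.prevRank g)) (Fin (G.rank g)) S :=
  G.diff g

/-- The matrix `σ ⊗ R` over `R = S ⧸ I`. -/
def lastMapQuot (G : MinimalFreeResolution I g) :
    Matrix (Fin (G.prevRank g)) (Fin (G.rank g)) (S ⧸ I) :=
  G.lastMap.map (Ideal.Quotient.mk I)

/-- The matrix `φ = σᵀ ⊗ R` over `R = S ⧸ I`. -/
def lastMapTransposeQuot (G : MinimalFreeResolution I g) :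
    Matrix (Fin (G.rank g)) (Fin (G.prevRank g)) (S ⧸ I) :=
  G.lastMap.transpose.map (Ideal.Quotient.mk I)

end MinimalFreeResolution

/-- The cokernel of a linear map. -/
abbrev Coker {R M N : Type*} [CommRing R] [AddCommGroup M] [Module R M] [AddCommGroup N]
    [Module R N] (f : M →ₗ[R] N) : Type _ :=
  N ⧸ LinearMap.range f

/-- `F₁ --φ--> F₀ --π--> M → 0` is a finite free presentation of `M`. -/
structure IsFreePresentation {R F₁ F₀ M : Type*} [CommRing R] [AddCommGroup F₁] [Module R F₁]
    [AddCommGroup F₀] [Module R F₀] [AddCommGroup M] [Module R M]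
    (φ : F₁ →ₗ[R] F₀) (π : F₀ →ₗ[R] M) : Prop where
  free₁ : Module.Free R F₁
  finite₁ : Module.Finite R F₁
  free₀ : Module.Free R F₀
  finite₀ : Module.Finite R F₀
  surjective : Function.Surjective π
  exact : Function.Exact φ π

/-- The Auslander dual `D(M) = coker (φ^* : F₀^* → F₁^*)` of a module `M`, formed from a finite
free presentation `F₁ --φ--> F₀ → M → 0`. -/
abbrev AuslanderDual {R F₁ F₀ : Type*} [CommRing R] [AddCommGroup F₁] [Module R F₁]
    [AddCommGroup F₀] [Module R F₀] (φ : F₁ →ₗ[R] F₀) : Type _ :=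
  Coker φ.dualMap

/-- The ideal `I_r(A)` generated by the `r × r` minors of the matrix `A`. -/
def minorsIdeal {R : Type*} [CommRing R] {m n : ℕ} (A : Matrix (Fin m) (Fin n) R) (r : ℕ) :
    Ideal R :=
  Ideal.span {x | ∃ (a : Fin r → Fin m) (b : Fin r → Fin n), x = (A.submatrix a b).det}
/-!
A regular local ring `S` is Gorenstein: its maximal ideal is generated by a regular sequence, so
cutting `S` down to its residue field shows that `S` is canonical over itself. For `R = S ⧸ I`,
the module `Ext_S^g(R, S)` is read off the dualized resolution as `coker (σᵀ ⊗ R)`. The other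
`Ext_S^i(R, S)` vanish, for `i < g` by the height of `I` and for `i > g` by the length of the
resolution, so change of rings `Ext_S^{g+i}(M, S) ≅ Ext_R^i(M, Ext_S^g(R, S))` makes `Ext_S^g(R, S)`
a canonical module of `R`.

Let `ω`, `ω'` be canonical modules of `R` and `d = dim R = depth R`. Nonzero classes in
`Ext_R^d(k, ω')` divide the classes in `Ext_R^d(k, ω)`, so some map `ω' → ω` is nonzero, hence
bijective, on `Ext_R^d(k, -)`. It is then injective modulo a maximal regular sequence, hence
injective, and its cokernel vanishes since all its `Ext_R^i(k, -)` do.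

A canonical module is faithful and its associated primes are minimal. Such a module is an ideal if
and only if it is generically cyclic, that is, if at every minimal prime `P` the matrix `φ` has
rank at least `p - 1` over the residue field of `P`; this says `I_{p-1}(φ) ⊄ P`. Moreover
`I_p(φ)` annihilates `coker φ`, so it vanishes.
-/

section ExtToolkit

open Abelian

lemma subsingleton_of_exact {X Y Z F G : Type*} [AddCommGroup X] [AddCommGroup Y] [Zero Z]
    [FunLike F X Y] [AddMonoidHomClass F X Y] [FunLike G Y Z] {f : F} {g : G}
    (h : Function.Exact f g) (hX : Subsingleton X) (hZ : Subsingleton Z) : Subsingleton Y :=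
  subsingleton_of_forall_eq 0 fun y ↦ by
    obtain ⟨x, rfl⟩ := (h y).mp (hZ.elim _ _)
    rw [hX.elim x 0, map_zero]

lemma injective_of_exact {X Y Z F G : Type*} [AddCommGroup X] [AddCommGroup Y] [AddCommGroup Z]
    [FunLike F X Y] [AddMonoidHomClass F X Y] [FunLike G Y Z] [AddMonoidHomClass G Y Z]
    {f : F} {g : G} (h : Function.Exact f g) (hX : Subsingleton X) : Function.Injective g :=
  (injective_iff_map_eq_zero g).mpr fun y hy ↦ by
    obtain ⟨x, rfl⟩ := (h y).mp hy
    rw [hX.elim x 0, map_zero]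

lemma surjective_of_exact {X Y Z : Type*} [Zero Z] {f : X → Y} {g : Y → Z}
    (h : Function.Exact f g) (hZ : Subsingleton Z) : Function.Surjective f :=
  fun y ↦ (h y).mp (hZ.elim _ _)

variable (A : Type u) [CommRing A]

/-- `Ext` groups of modules, with unbundled arguments. -/
abbrev ExtM (M N : Type u) [AddCommGroup M] [Module A M] [AddCommGroup N] [Module A N]
    (i : ℕ) : Type u :=
  Abelian.Ext (ModuleCat.of A M) (ModuleCat.of A N) i

variable {A}
variable {M M' M'' N N' N'' : Type u}
  [AddCommGroup M] [Module A M] [AddCommGroup M'] [Module A M'] [AddCommGroup M''] [Module A M'']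
  [AddCommGroup N] [Module A N] [AddCommGroup N'] [Module A N'] [AddCommGroup N''] [Module A N'']

namespace ExtM

/-- `Ext⁰` is `Hom`. -/
noncomputable def zeroEquiv : ExtM A M N 0 ≃ₗ[A] (M →ₗ[A] N) :=
  Ext.linearEquiv₀.trans ModuleCat.homLinearEquiv

/-- The map on `Ext` induced by a linear map in the first variable. -/
noncomputable def pre (N : Type u) [AddCommGroup N] [Module A N] (i : ℕ) :
    (M →ₗ[A] M') →ₗ[A] ExtM A M' N i →ₗ[A] ExtM A M N i :=
  Ext.bilinearCompOfLinear A _ _ _ 0 i i (zero_add i) ∘ₗ zeroEquiv.symm.toLinearMap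

/-- The map on `Ext` induced by a linear map in the second variable. -/
noncomputable def post (M : Type u) [AddCommGroup M] [Module A M] (i : ℕ) :
    (N →ₗ[A] N') →ₗ[A] ExtM A M N i →ₗ[A] ExtM A M N' i :=
  (Ext.bilinearCompOfLinear A _ _ _ i 0 i (add_zero i)).flip ∘ₗ zeroEquiv.symm.toLinearMap

lemma zeroEquiv_symm_apply (f : M →ₗ[A] N) :
    zeroEquiv.symm f = Ext.mk₀ (ModuleCat.ofHom f) := rfl

lemma pre_apply (i : ℕ) (f : M →ₗ[A] M') (x : ExtM A M' N i) :
    pre N i f x = (Ext.mk₀ (ModuleCat.ofHom f)).comp x (zero_add i) := rfl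

lemma post_apply (i : ℕ) (f : N →ₗ[A] N') (x : ExtM A M N i) :
    post M i f x = x.comp (Ext.mk₀ (ModuleCat.ofHom f)) (add_zero i) := rfl

@[simp]
lemma pre_id (i : ℕ) : pre N i (LinearMap.id : M →ₗ[A] M) = LinearMap.id := by
  ext x
  rw [pre_apply, ModuleCat.ofHom_id]
  exact Ext.mk₀_id_comp x

@[simp]
lemma post_id (i : ℕ) : post M i (LinearMap.id : N →ₗ[A] N) = LinearMap.id := by
  ext x
  rw [post_apply, ModuleCat.ofHom_id]
  exact Ext.comp_mk₀_id x

lemma pre_comp (i : ℕ) (f : M →ₗ[A] M') (g : M' →ₗ[A] M'') :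
    pre N i (g ∘ₗ f) = pre N i f ∘ₗ pre N i g := by
  ext x
  simp only [LinearMap.comp_apply, pre_apply, ModuleCat.ofHom_comp, Ext.mk₀_comp_mk₀_assoc]

lemma pre_smul_id (i : ℕ) (r : A) (x : ExtM A M N i) :
    pre N i (r • (LinearMap.id : M →ₗ[A] M)) x = r • x := by
  simp

lemma post_smul_id (i : ℕ) (r : A) (x : ExtM A M N i) :
    post M i (r • (LinearMap.id : N →ₗ[A] N)) x = r • x := by
  simp

/-- Isomorphic modules have isomorphic `Ext` in the first variable. -/
noncomputable def congrLeft (e : M ≃ₗ[A] M') (N : Type u) [AddCommGroup N] [Module A N] (i : ℕ) :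
    ExtM A M N i ≃ₗ[A] ExtM A M' N i :=
  LinearEquiv.ofLinearMap (pre N i e.symm.toLinearMap) (pre N i e.toLinearMap)
    (by simp [← pre_comp]) (by simp [← pre_comp])

lemma annihilator_le_left (i : ℕ) :
    Module.annihilator A M ≤ Module.annihilator A (ExtM A M N i) := fun r hr ↦ by
  rw [Module.mem_annihilator] at hr ⊢
  have h : r • (LinearMap.id : M →ₗ[A] M) = 0 := LinearMap.ext hr
  intro x
  rw [← pre_smul_id, h, map_zero, LinearMap.zero_apply]

lemma annihilator_le_right (i : ℕ) :
    Module.annihilator A N ≤ Module.annihilator A (ExtM A M N i) := fun r hr ↦ by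
  rw [Module.mem_annihilator] at hr ⊢
  have h : r • (LinearMap.id : N →ₗ[A] N) = 0 := LinearMap.ext hr
  intro x
  rw [← post_smul_id, h, map_zero, LinearMap.zero_apply]

lemma pre_zeroEquiv_symm (f : M →ₗ[A] M') (g : M' →ₗ[A] N) :
    pre N 0 f (zeroEquiv.symm g) = zeroEquiv.symm (g ∘ₗ f) := by
  simp only [pre_apply, zeroEquiv_symm_apply, Ext.mk₀_comp_mk₀, ModuleCat.ofHom_comp]

lemma post_zeroEquiv_symm (f : N →ₗ[A] N') (g : M →ₗ[A] N) :
    post M 0 f (zeroEquiv.symm g) = zeroEquiv.symm (f ∘ₗ g) := by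
  simp only [post_apply, zeroEquiv_symm_apply, Ext.mk₀_comp_mk₀, ModuleCat.ofHom_comp]

lemma subsingleton_of_subsingleton_left [h : Subsingleton M] (i : ℕ) :
    Subsingleton (ExtM A M N i) := by
  rw [← Module.annihilator_eq_top_iff (R := A)] at h ⊢
  exact top_le_iff.mp (h.ge.trans (annihilator_le_left i))

lemma subsingleton_of_subsingleton_right [h : Subsingleton N] (i : ℕ) :
    Subsingleton (ExtM A M N i) := by
  rw [← Module.annihilator_eq_top_iff (R := A)] at h ⊢
  exact top_le_iff.mp (h.ge.trans (annihilator_le_right i))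

lemma subsingleton_of_projective [Module.Projective A M] (i : ℕ) :
    Subsingleton (ExtM A M N (i + 1)) := by
  have : Projective (ModuleCat.of A M) :=
    (IsProjective.iff_projective (R := A) M).mp inferInstance
  exact Ext.subsingleton_of_projective _ _ i

end ExtM

/-- `0 → M → M' → M'' → 0` is a short exact sequence. -/
structure IsShortExact (f : M →ₗ[A] M') (g : M' →ₗ[A] M'') : Prop where
  injective : Function.Injective f
  surjective : Function.Surjective g
  exact : Function.Exact f g

namespace IsShortExact

lemma of_ker {g : M →ₗ[A] M''} (hg : Function.Surjective g) :
    IsShortExact (LinearMap.ker g).subtype g :=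
  ⟨Subtype.val_injective, hg, g.exact_subtype_ker_map⟩

lemma of_range {f : M →ₗ[A] M'} (hf : Function.Injective f) :
    IsShortExact f (LinearMap.range f).mkQ :=
  ⟨hf, Submodule.mkQ_surjective _, f.exact_map_mkQ_range⟩

open Pointwise in
lemma of_isSMulRegular {r : A} (h : IsSMulRegular M r) :
    IsShortExact (r • LinearMap.id : M →ₗ[A] M) (r • (⊤ : Submodule A M)).mkQ :=
  ⟨h, Submodule.mkQ_surjective _, LinearMap.exact_lsmul_mkQ_smul_top M r⟩

open ExtM

variable {f : M →ₗ[A] M'} {g : M' →ₗ[A] M''}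

lemma shortExact (h : IsShortExact f g) :
    (ModuleCat.shortComplexOfCompEqZero f g h.exact.linearMap_comp_eq_zero).ShortExact where
  exact := ModuleCat.shortComplex_exact _ h.exact
  mono_f := (ModuleCat.mono_iff_injective _).mpr h.injective
  epi_g := (ModuleCat.epi_iff_surjective _).mpr h.surjective

/-- The class of a short exact sequence in `Ext¹`. -/
noncomputable def cls (h : IsShortExact f g) : ExtM A M'' M 1 := h.shortExact.extClass

/-- The contravariant connecting map. -/
noncomputable def preδ (h : IsShortExact f g) (N : Type u) [AddCommGroup N] [Module A N] (i : ℕ) :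
    ExtM A M N i →ₗ[A] ExtM A M'' N (i + 1) :=
  h.cls.precompOfLinear A _ (add_comm 1 i)

/-- The covariant connecting map. -/
noncomputable def postδ (h : IsShortExact f g) (N : Type u) [AddCommGroup N] [Module A N] (i : ℕ) :
    ExtM A N M'' i →ₗ[A] ExtM A N M (i + 1) :=
  h.cls.postcompOfLinear A _ rfl

lemma preδ_apply (h : IsShortExact f g) (i : ℕ) (x : ExtM A M N i) :
    h.preδ N i x = Ext.comp h.cls x (add_comm 1 i) := rfl

lemma postδ_apply (h : IsShortExact f g) (i : ℕ) (x : ExtM A N M'' i) :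
    h.postδ N i x = Ext.comp x h.cls rfl := rfl

lemma pre_exact₂ (h : IsShortExact f g) (N : Type u) [AddCommGroup N] [Module A N] (i : ℕ) :
    Function.Exact (pre N i g) (pre N i f) :=
  (ShortComplex.ab_exact_iff_function_exact _).mp
    (Ext.contravariant_sequence_exact₂' h.shortExact (ModuleCat.of A N) i)

lemma pre_exact₁ (h : IsShortExact f g) (N : Type u) [AddCommGroup N] [Module A N] (i : ℕ) :
    Function.Exact (pre N i f) (h.preδ N i) :=
  (ShortComplex.ab_exact_iff_function_exact _).mp
    (Ext.contravariant_sequence_exact₁' h.shortExact (ModuleCat.of A N) i (i + 1) (add_comm 1 i))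

lemma pre_exact₃ (h : IsShortExact f g) (N : Type u) [AddCommGroup N] [Module A N] (i : ℕ) :
    Function.Exact (h.preδ N i) (pre N (i + 1) g) :=
  (ShortComplex.ab_exact_iff_function_exact _).mp
    (Ext.contravariant_sequence_exact₃' h.shortExact (ModuleCat.of A N) i (i + 1) (add_comm 1 i))

lemma post_exact₂ (h : IsShortExact f g) (N : Type u) [AddCommGroup N] [Module A N] (i : ℕ) :
    Function.Exact (post N i f) (post N i g) :=
  (ShortComplex.ab_exact_iff_function_exact _).mp
    (Ext.covariant_sequence_exact₂' (ModuleCat.of A N) h.shortExact i)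

lemma post_exact₃ (h : IsShortExact f g) (N : Type u) [AddCommGroup N] [Module A N] (i : ℕ) :
    Function.Exact (post N i g) (h.postδ N i) :=
  (ShortComplex.ab_exact_iff_function_exact _).mp
    (Ext.covariant_sequence_exact₃' (ModuleCat.of A N) h.shortExact i (i + 1) rfl)

lemma post_exact₁ (h : IsShortExact f g) (N : Type u) [AddCommGroup N] [Module A N] (i : ℕ) :
    Function.Exact (h.postδ N i) (post N (i + 1) f) :=
  (ShortComplex.ab_exact_iff_function_exact _).mp
    (Ext.covariant_sequence_exact₁' (ModuleCat.of A N) h.shortExact i (i + 1) rfl)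

lemma pre_injective_zero (h : IsShortExact f g) (N : Type u) [AddCommGroup N] [Module A N] :
    Function.Injective (pre N 0 g) := by
  have := h.shortExact.epi_g
  exact Ext.precomp_mk₀_injective_of_epi _ (ModuleCat.ofHom g)

/-- Dimension shifting. -/
noncomputable def shiftEquiv (h : IsShortExact f g) [Module.Projective A M'] (N : Type u)
    [AddCommGroup N] [Module A N] (i : ℕ) :
    ExtM A M N (i + 1) ≃ₗ[A] ExtM A M'' N (i + 2) :=
  .ofBijective (h.preδ N (i + 1))
    ⟨injective_of_exact (h.pre_exact₁ N (i + 1)) (subsingleton_of_projective i),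
      surjective_of_exact (h.pre_exact₃ N (i + 1)) (subsingleton_of_projective (i + 1))⟩

end IsShortExact

end ExtToolkit

section LocalRing

open ExtM Pointwise

variable {A : Type u} [CommRing A] [IsLocalRing A]

lemma subsingleton_of_smul_surjective {E : Type*} [AddCommGroup E] [Module A E]
    [Module.Finite A E] {x : A} (hx : x ∈ maximalIdeal A) (h : ∀ e : E, ∃ e' : E, x • e' = e) :
    Subsingleton E := by
  by_contra! hE
  refine Submodule.top_ne_pointwise_smul_of_mem_jacobson_annihilator (M := E)
    (maximalIdeal_le_jacobson _ hx) ?_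
  rw [eq_comm, eq_top_iff]
  intro e _
  obtain ⟨e', rfl⟩ := h e
  exact Submodule.smul_mem_pointwise_smul _ _ ⊤ trivial

lemma exists_mem_maximalIdeal_notMem {p : Ideal A} (hp : p ≠ ⊤) (hpm : p ≠ maximalIdeal A) :
    ∃ x ∈ maximalIdeal A, x ∉ p := by
  by_contra! h
  exact hpm (le_antisymm (le_maximalIdeal hp) h)

lemma isSMulRegular_quotient_prime {A : Type*} [CommRing A] {p : Ideal A} [p.IsPrime] {x : A}
    (hx : x ∉ p) : IsSMulRegular (A ⧸ p) x := by
  intro a b hab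
  simp only [Algebra.smul_def, Ideal.Quotient.algebraMap_eq] at hab
  exact mul_left_cancel₀ (fun h ↦ hx (Ideal.Quotient.eq_zero_iff_mem.mp h)) hab

lemma ext_quotSMulTop_subsingleton {A M N : Type u} [CommRing A] [AddCommGroup M] [Module A M]
    [AddCommGroup N] [Module A N] {x : A} (reg : IsSMulRegular N x) {i : ℕ}
    (h : Subsingleton (ExtM A M N i)) (h' : Subsingleton (ExtM A M N (i + 1))) :
    Subsingleton (ExtM A M (QuotSMulTop x N) i) :=
  subsingleton_of_exact ((IsShortExact.of_isSMulRegular reg).post_exact₃ M i) h h'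

lemma zero_le_supportDim (A M : Type*) [CommRing A] [AddCommGroup M] [Module A M]
    [Nontrivial M] : 0 ≤ Module.supportDim A M :=
  Order.krullDim_nonneg_iff.mpr Module.nonempty_support_of_nontrivial.to_subtype

lemma supportDim_le_of_support_subset {A M N : Type*} [CommRing A] [AddCommGroup M] [Module A M]
    [AddCommGroup N] [Module A N] (h : Module.support A M ⊆ Module.support A N) :
    Module.supportDim A M ≤ Module.supportDim A N :=
  Order.krullDim_le_of_strictMono (Set.inclusion h) fun _ _ ↦ id

variable [IsNoetherianRing A]

/-- Noetherian induction on the annihilator: a prime cyclic module `A ⧸ p` with `p` not maximal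
has a regular element in the maximal ideal, and dividing by it enlarges the annihilator. -/
theorem finite_module_induction
    {motive : (M : Type u) → [AddCommGroup M] → [Module A M] → [Module.Finite A M] → Prop}
    (subsingleton : ∀ (M : Type u) [AddCommGroup M] [Module A M] [Module.Finite A M]
      [Subsingleton M], motive M)
    (residue : ∀ (M : Type u) [AddCommGroup M] [Module A M] [Module.Finite A M],
      (M ≃ₗ[A] ResidueField A) → motive M)
    (exact : ∀ (M₁ M₂ M₃ : Type u) [AddCommGroup M₁] [Module A M₁] [Module.Finite A M₁]
      [AddCommGroup M₂] [Module A M₂] [Module.Finite A M₂]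
      [AddCommGroup M₃] [Module A M₃] [Module.Finite A M₃] (f : M₁ →ₗ[A] M₂) (g : M₂ →ₗ[A] M₃),
      IsShortExact f g → motive M₁ → motive M₃ → motive M₂)
    (regular : ∀ (M : Type u) [AddCommGroup M] [Module A M] [Module.Finite A M] (x : A),
      x ∈ maximalIdeal A → IsSMulRegular M x → motive (QuotSMulTop x M) → motive M)
    ⦃M : Type u⦄ [AddCommGroup M] [Module A M] (_ : Module.Finite A M) : motive M := by
  suffices H : ∀ (a : Ideal A) (M : Type u) [AddCommGroup M] [Module A M] [Module.Finite A M],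
      a ≤ Module.annihilator A M → motive M from H ⊥ M bot_le
  intro a
  induction a using WellFoundedGT.induction with
  | _ a iha =>
  intro M _ _ hM ha
  induction hM using IsNoetherianRing.induction_on_isQuotientEquivQuotientPrime A with
  | subsingleton M => exact subsingleton M
  | quotient M p e =>
    have := p.2
    by_cases hp : p.1 = maximalIdeal A
    · exact residue M (e.trans (Submodule.quotEquivOfEq _ _ hp))
    · obtain ⟨x, hxm, hxp⟩ := exists_mem_maximalIdeal_notMem p.2.ne_top hp
      have reg : IsSMulRegular M x :=
        (LinearEquiv.isSMulRegular_congr e x).mpr (isSMulRegular_quotient_prime hxp)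
      have hap : a ≤ p.1 := by rwa [e.annihilator_eq, Ideal.annihilator_quotient] at ha
      refine regular M x hxm reg (iha (a ⊔ Ideal.span {x}) ?_ _ (sup_le ?_ ?_))
      · exact left_lt_sup.mpr fun h ↦ hxp (hap (h (Ideal.mem_span_singleton_self x)))
      · exact ha.trans (LinearMap.annihilator_le_of_surjective _ (Submodule.mkQ_surjective _))
      · rw [Ideal.span_singleton_le_iff_mem]
        exact QuotSMulTop.mem_annihilator M x
  | exact M₁ M₂ M₃ f g hf hg hfg h₁ h₃ =>
    exact exact M₁ M₂ M₃ f g ⟨hf, hg, hfg⟩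
      (h₁ (ha.trans (LinearMap.annihilator_le_of_injective f hf)))
      (h₃ (ha.trans (LinearMap.annihilator_le_of_surjective g hg)))

variable {M N : Type u} [AddCommGroup M] [Module A M] [Module.Finite A M]
  [AddCommGroup N] [Module A N] [Module.Finite A N]

lemma ext_subsingleton_of_quotSMulTop {x : A} (hx : x ∈ maximalIdeal A) (reg : IsSMulRegular M x)
    {i : ℕ} (h : Subsingleton (ExtM A (QuotSMulTop x M) N (i + 1))) :
    Subsingleton (ExtM A M N i) :=
  subsingleton_of_smul_surjective hx fun y ↦ by
    obtain ⟨z, hz⟩ := ((IsShortExact.of_isSMulRegular reg).pre_exact₁ N i y).mp (h.elim _ _)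
    exact ⟨z, by rw [← hz, pre_smul_id]⟩

theorem ext_subsingleton_of_residueField {i : ℕ}
    (h : ∀ j : ℕ, (j : WithBot ℕ∞) ≤ Module.supportDim A M →
      Subsingleton (ExtM A (ResidueField A) N (i + j))) :
    Subsingleton (ExtM A M N i) := by
  induction ‹Module.Finite A M› using finite_module_induction generalizing i with
  | subsingleton M => exact subsingleton_of_subsingleton_left i
  | residue M e =>
    have : Nontrivial M := e.toEquiv.nontrivial
    have := h 0 (zero_le_supportDim A M)
    exact (congrLeft e N i).toEquiv.subsingleton
  | exact M₁ M₂ M₃ f g hfg h₁ h₃ =>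
    exact subsingleton_of_exact (hfg.pre_exact₂ N i)
      (h₃ fun j hj ↦ h j (hj.trans (Module.supportDim_le_of_surjective g hfg.surjective)))
      (h₁ fun j hj ↦ h j (hj.trans (Module.supportDim_le_of_injective f hfg.injective)))
  | regular M x hx reg ih =>
    refine ext_subsingleton_of_quotSMulTop hx reg (ih fun j hj ↦ ?_)
    rw [add_assoc, add_comm 1 j]
    refine h (j + 1) ?_
    rw [← Module.supportDim_quotSMulTop_succ_eq_supportDim reg hx, Nat.cast_add_one]
    exact add_le_add_left hj 1

lemma subsingleton_of_ext_residueField_subsingleton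
    (h : ∀ j : ℕ, (j : WithBot ℕ∞) ≤ Module.supportDim A N →
      Subsingleton (ExtM A (ResidueField A) N j)) : Subsingleton N := by
  have : Subsingleton (N →ₗ[A] N) :=
    have := ext_subsingleton_of_residueField (M := N) (N := N) (i := 0) (by simpa using h)
    (zeroEquiv (A := A)).symm.toEquiv.subsingleton
  have hid : (LinearMap.id : N →ₗ[A] N) = 0 := Subsingleton.elim _ _
  exact subsingleton_of_forall_eq 0 (LinearMap.congr_fun hid)

lemma isSMulRegular_of_ext_residueField {B : Type*} [AddCommGroup B] [Module A B]
    [Module.Finite A B] (hsupp : Module.support A N ⊆ Module.support A B)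
    (h : ∀ j : ℕ, (j : WithBot ℕ∞) + 1 ≤ Module.supportDim A B →
      Subsingleton (ExtM A (ResidueField A) N j))
    {x : A} (hx : x ∈ maximalIdeal A) (reg : IsSMulRegular B x) : IsSMulRegular N x := by
  refine isSMulRegular_iff_right_eq_zero_of_smul.mpr fun w hw ↦ ?_
  let W := Submodule.span A {w}
  have hW : Module.support A W ⊆ Module.support A (QuotSMulTop x B) := by
    rw [Module.support_quotSMulTop]
    refine Set.subset_inter ((Module.support_subset_of_injective W.subtype
      W.injective_subtype).trans hsupp) fun P hP ↦ ?_
    rw [Module.support_eq_zeroLocus] at hP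
    refine fun r hr ↦ hP ?_
    rw [Set.mem_singleton_iff.mp hr, SetLike.mem_coe, Submodule.mem_annihilator_span_singleton]
    exact hw
  have : Subsingleton (ExtM A W N 0) := ext_subsingleton_of_residueField fun j hj ↦ by
    rw [zero_add]
    refine h j ?_
    rw [← Module.supportDim_quotSMulTop_succ_eq_supportDim reg hx]
    exact add_le_add_left (hj.trans (supportDim_le_of_support_subset hW)) 1
  have hsub : W.subtype = 0 := zeroEquiv.symm.injective (Subsingleton.elim _ _)
  exact LinearMap.congr_fun hsub ⟨w, Submodule.mem_span_singleton_self w⟩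

theorem isWeaklyRegular_of_ext_residueField {B : Type*} [AddCommGroup B] [Module A B]
    [Module.Finite A B] (hsupp : Module.support A N ⊆ Module.support A B)
    (h : ∀ j : ℕ, (j : WithBot ℕ∞) + 1 ≤ Module.supportDim A B →
      Subsingleton (ExtM A (ResidueField A) N j))
    {rs : List A} (hrs : ∀ r ∈ rs, r ∈ maximalIdeal A)
    (reg : RingTheory.Sequence.IsWeaklyRegular B rs) :
    RingTheory.Sequence.IsWeaklyRegular N rs := by
  induction rs generalizing N B with
  | nil => exact .nil A N
  | cons x rs ih =>
    rw [RingTheory.Sequence.isWeaklyRegular_cons_iff] at reg ⊢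
    have hx : x ∈ maximalIdeal A := hrs x List.mem_cons_self
    have regN := isSMulRegular_of_ext_residueField hsupp h hx reg.1
    refine ⟨regN, ih ?_ (fun j hj ↦ ?_) (fun r hr ↦ hrs r (List.mem_cons_of_mem _ hr)) reg.2⟩
    · simp only [Module.support_quotSMulTop]
      exact Set.inter_subset_inter_left _ hsupp
    · have hj' : ((j + 1 : ℕ) : WithBot ℕ∞) + 1 ≤ Module.supportDim A B := by
        rw [← Module.supportDim_quotSMulTop_succ_eq_supportDim reg.1 hx, Nat.cast_add_one]
        exact add_le_add_left hj 1
      refine ext_quotSMulTop_subsingleton regN (h j ?_) (h (j + 1) hj')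
      exact le_trans (by norm_cast; simp) hj'

end LocalRing

section CanonicalModule

open ExtM Pointwise RingTheory.Sequence

section Naturality

variable {A M M' M'' N N' N'' : Type u} [CommRing A] [AddCommGroup M] [Module A M]
  [AddCommGroup M'] [Module A M'] [AddCommGroup M''] [Module A M''] [AddCommGroup N] [Module A N]
  [AddCommGroup N'] [Module A N'] [AddCommGroup N''] [Module A N'']
  {f : M →ₗ[A] M'} {g : M' →ₗ[A] M''} {f' : N →ₗ[A] N'} {g' : N' →ₗ[A] N''}
  {a : M →ₗ[A] N} {b : M' →ₗ[A] N'} {c : M'' →ₗ[A] N''}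

lemma IsShortExact.post_cls (h : IsShortExact f g) (h' : IsShortExact f' g')
    (hab : b ∘ₗ f = f' ∘ₗ a) (hbc : c ∘ₗ g = g' ∘ₗ b) :
    post M'' 1 a h.cls = pre N 1 c h'.cls := by
  let φ : ModuleCat.shortComplexOfCompEqZero f g h.exact.linearMap_comp_eq_zero ⟶
      ModuleCat.shortComplexOfCompEqZero f' g' h'.exact.linearMap_comp_eq_zero :=
    { τ₁ := ModuleCat.ofHom a
      τ₂ := ModuleCat.ofHom b
      τ₃ := ModuleCat.ofHom c
      comm₁₂ := ModuleCat.hom_ext hab.symm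
      comm₂₃ := ModuleCat.hom_ext hbc.symm }
  exact ShortComplex.ShortExact.extClass_naturality h.shortExact h'.shortExact φ

lemma IsShortExact.post_postδ (h : IsShortExact f g) (h' : IsShortExact f' g')
    (hab : b ∘ₗ f = f' ∘ₗ a) (hbc : c ∘ₗ g = g' ∘ₗ b) {L : Type u} [AddCommGroup L] [Module A L]
    (i : ℕ) (x : ExtM A L M'' i) :
    post L (i + 1) a (h.postδ L i x) = h'.postδ L i (post L i c x) := by
  have hcls := h.post_cls h' hab hbc
  rw [post_apply, pre_apply] at hcls
  rw [post_apply, post_apply, postδ_apply, postδ_apply, Abelian.Ext.comp_assoc_of_third_deg_zero,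
    hcls, Abelian.Ext.comp_assoc_of_second_deg_zero]

end Naturality

variable {A : Type u} [CommRing A] [IsLocalRing A]

lemma isSimpleModule_residueField (A : Type*) [CommRing A] [IsLocalRing A] :
    IsSimpleModule A (ResidueField A) :=
  isSimpleModule_iff_quot_maximal.mpr
    ⟨maximalIdeal A, inferInstance, ⟨LinearEquiv.refl A (A ⧸ maximalIdeal A)⟩⟩

lemma exists_surjective_residueField (A M : Type*) [CommRing A] [IsLocalRing A] [AddCommGroup M]
    [Module A M] [Module.Finite A M] [Nontrivial M] :
    ∃ f : M →ₗ[A] ResidueField A, Function.Surjective f := by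
  obtain ⟨P, hP, -⟩ := (eq_top_or_exists_le_coatom (⊥ : Submodule A M)).resolve_left bot_ne_top
  have := isSimpleModule_iff_isCoatom.mpr hP
  obtain ⟨I, hI, ⟨e⟩⟩ := isSimpleModule_iff_quot_maximal.mp this
  obtain rfl := eq_maximalIdeal hI
  exact ⟨e.toLinearMap ∘ₗ P.mkQ, e.surjective.comp P.mkQ_surjective⟩

lemma supportDim_nonpos_of_maximalIdeal_pow_le {M : Type*} [AddCommGroup M] [Module A M]
    [Module.Finite A M] {t : ℕ} (h : maximalIdeal A ^ t ≤ Module.annihilator A M) :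
    Module.supportDim A M ≤ 0 := by
  have hmax (P : Module.support A M) : P.1.1 = maximalIdeal A := by
    have := P.1.2
    have hP := Module.mem_support_iff_of_finite.mp P.2
    exact le_antisymm (le_maximalIdeal P.1.2.ne_top) (P.1.2.le_of_pow_le (h.trans hP))
  have : Subsingleton (Module.support A M) :=
    ⟨fun P Q ↦ Subtype.ext (PrimeSpectrum.ext ((hmax P).trans (hmax Q).symm))⟩
  exact Order.krullDim_nonpos_of_subsingleton

lemma exists_natCast_eq_ringKrullDim (A : Type*) [CommRing A] [IsLocalRing A]
    [IsNoetherianRing A] : ∃ d : ℕ, (d : WithBot ℕ∞) = ringKrullDim A :=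
  ⟨_, Order.krullDim_eq_length_of_finiteDimensionalOrder.symm⟩

variable [IsNoetherianRing A]
  {M N N' ω : Type u} [AddCommGroup M] [Module A M] [Module.Finite A M]
  [AddCommGroup N] [Module A N] [Module.Finite A N] [AddCommGroup N'] [Module A N']
  [AddCommGroup ω] [Module A ω] [Module.Finite A ω] {d : ℕ}

lemma ext_subsingleton_of_lt_add_length
    (hω : ∀ i, d < i → Subsingleton (ExtM A (ResidueField A) ω i)) {rs : List A}
    (hrs : ∀ r ∈ rs, r ∈ maximalIdeal A) (reg : IsWeaklyRegular M rs) {i : ℕ}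
    (hi : d < i + rs.length) : Subsingleton (ExtM A M ω i) := by
  induction rs generalizing M i with
  | nil =>
    exact ext_subsingleton_of_residueField fun j _ ↦ hω (i + j) (hi.trans_le (Nat.le_add_right i j))
  | cons x rs ih =>
    rw [isWeaklyRegular_cons_iff] at reg
    refine ext_subsingleton_of_quotSMulTop (hrs x List.mem_cons_self) reg.1
      (ih (fun r hr ↦ hrs r (List.mem_cons_of_mem _ hr)) reg.2 ?_)
    rw [List.length_cons] at hi
    omega

/-- Every nonzero class in `Extʳ(k, M)`, `r` the length of an `M`-regular sequence, divides
every class in the top degree `Extᵈ(k, ω)`: both sides shift to `r = 0`, where the class is an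
embedding `k → M` and `Extᵈ⁺¹(M / k, ω) = 0`. -/
lemma exists_comp_eq
    (hω : ∀ i, d < i → Subsingleton (ExtM A (ResidueField A) ω i)) {rs : List A}
    (hrs : ∀ r ∈ rs, r ∈ maximalIdeal A) (reg : IsWeaklyRegular M rs) {j : ℕ}
    (hj : rs.length + j = d) {η : ExtM A (ResidueField A) M rs.length} (hη : η ≠ 0)
    (c : ExtM A (ResidueField A) ω d) :
    ∃ ζ : ExtM A M ω j, Abelian.Ext.comp η ζ hj = c := by
  induction rs generalizing M j with
  | nil =>
    obtain rfl : j = d := by simpa using hj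
    obtain ⟨f, rfl⟩ := zeroEquiv.symm.surjective η
    have := isSimpleModule_residueField A
    have hf : Function.Injective f :=
      (LinearMap.injective_or_eq_zero f).resolve_right fun h ↦ hη (by rw [h, map_zero])
    have hM : Subsingleton (ExtM A (M ⧸ LinearMap.range f) ω (j + 1)) :=
      ext_subsingleton_of_residueField fun i _ ↦ hω (j + 1 + i) (by omega)
    exact surjective_of_exact ((IsShortExact.of_range hf).pre_exact₁ ω j) hM c
  | cons x rs ih =>
    have hM := ext_subsingleton_of_lt_add_length hω hrs reg (i := j + 1) (by omega)
    rw [isWeaklyRegular_cons_iff] at reg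
    have h := IsShortExact.of_isSMulRegular reg.1
    have hx : x ∈ Module.annihilator A (ResidueField A) :=
      (Ideal.annihilator_quotient (I := maximalIdeal A)).ge (hrs x List.mem_cons_self)
    have h0 : post (ResidueField A) (rs.length + 1) (x • LinearMap.id : M →ₗ[A] M) η = 0 := by
      rw [post_smul_id]
      exact Module.mem_annihilator.mp (annihilator_le_left _ hx) η
    obtain ⟨η', rfl⟩ := (h.post_exact₁ _ rs.length η).mp h0
    have hη' : η' ≠ 0 := fun h ↦ hη (by rw [h, map_zero])
    rw [List.length_cons] at hj
    obtain ⟨ζ, hζ⟩ := ih (fun r hr ↦ hrs r (List.mem_cons_of_mem _ hr)) reg.2 (j := j + 1)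
      (by omega) hη'
    obtain ⟨ζ', rfl⟩ := surjective_of_exact (h.pre_exact₃ ω j) hM ζ
    refine ⟨ζ', ?_⟩
    rw [← hζ, IsShortExact.postδ_apply, IsShortExact.preδ_apply]
    exact Abelian.Ext.comp_assoc _ _ _ _ _ (by omega)

lemma injective_of_post_zero_injective {f : N →ₗ[A] N'} (hN : Module.supportDim A N ≤ 0)
    (hf : Function.Injective (post (ResidueField A) 0 f)) : Function.Injective f := by
  have hker : Subsingleton (ResidueField A →ₗ[A] LinearMap.ker f) := by
    refine subsingleton_of_forall_eq 0 fun u ↦ ?_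
    have hu : (LinearMap.ker f).subtype ∘ₗ u = 0 :=
      zeroEquiv.symm.injective (hf (by
        rw [post_zeroEquiv_symm, map_zero, map_zero]
        exact zeroEquiv.symm.map_eq_zero_iff.mpr (LinearMap.ext fun y ↦ (u y).2)))
    exact LinearMap.ext fun y ↦ Subtype.ext (LinearMap.congr_fun hu y)
  rw [← LinearMap.ker_eq_bot, ← Submodule.subsingleton_iff_eq_bot]
  refine subsingleton_of_ext_residueField_subsingleton (A := A) fun j hj ↦ ?_
  have hdim := Module.supportDim_le_of_injective (R := A) _ (LinearMap.ker f).injective_subtype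
  obtain rfl : j = 0 := by simpa using hj.trans (hdim.trans hN)
  exact zeroEquiv.toEquiv.subsingleton

lemma injective_of_quotSMulTop_map_injective {x : A} (hx : x ∈ maximalIdeal A)
    (reg : IsSMulRegular N' x) {f : N →ₗ[A] N'} (hf : Function.Injective (QuotSMulTop.map x f)) :
    Function.Injective f := by
  rw [← LinearMap.ker_eq_bot, ← Submodule.subsingleton_iff_eq_bot]
  refine subsingleton_of_smul_surjective hx fun ⟨w, hw⟩ ↦ ?_
  have hxw : Submodule.Quotient.mk (p := x • (⊤ : Submodule A N)) w = 0 := by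
    apply hf
    rw [QuotSMulTop.map_apply_mk, LinearMap.mem_ker.mp hw, map_zero, Submodule.Quotient.mk_zero]
  obtain ⟨n, -, rfl⟩ := (Submodule.Quotient.mk_eq_zero _).mp hxw
  refine ⟨⟨n, reg ?_⟩, rfl⟩
  simpa using hw

/-- `Extʳ(k, N)` is the socle of `N / (rs)N`, which detects injectivity on `N / (rs)N`. -/
lemma injective_of_post_length_injective {rs : List A} (hrs : ∀ r ∈ rs, r ∈ maximalIdeal A)
    (reg : IsWeaklyRegular N rs) (reg' : IsWeaklyRegular N' rs)
    (hN : Module.supportDim A N ≤ rs.length)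
    (hext : ∀ i < rs.length, Subsingleton (ExtM A (ResidueField A) N i)) {f : N →ₗ[A] N'}
    (hf : Function.Injective (post (ResidueField A) rs.length f)) : Function.Injective f := by
  induction rs generalizing N N' with
  | nil => exact injective_of_post_zero_injective (by simpa using hN) hf
  | cons x rs ih =>
    rw [isWeaklyRegular_cons_iff] at reg reg'
    have hx := hrs x List.mem_cons_self
    have h := IsShortExact.of_isSMulRegular reg.1
    have hδ : Function.Injective (h.postδ (ResidueField A) rs.length) :=
      injective_of_exact (h.post_exact₃ _ rs.length) (hext rs.length (by simp))
    refine injective_of_quotSMulTop_map_injective hx reg'.1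
      (ih (fun r hr ↦ hrs r (List.mem_cons_of_mem _ hr)) reg.2 reg'.2 ?_ (fun i hi ↦ ?_) ?_)
    · rw [← Module.supportDim_quotSMulTop_succ_eq_supportDim reg.1 hx, List.length_cons,
        Nat.cast_add_one] at hN
      exact ENat.WithBot.add_le_add_one_right_iff.mp hN
    · exact ext_quotSMulTop_subsingleton reg.1 (hext i (by simp; omega)) (hext (i + 1) (by simpa))
    · intro y z hyz
      have h' := IsShortExact.of_isSMulRegular reg'.1
      have hnat := h.post_postδ h' (a := f) (b := f) (c := QuotSMulTop.map x f)
        (LinearMap.ext fun n ↦ f.map_smul x n) rfl (L := ResidueField A) rs.length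
      apply hδ
      apply hf
      exact (hnat y).trans ((congrArg _ hyz).trans (hnat z).symm)

omit [Module.Finite A N] in
lemma surjective_of_post_bijective [Module.Finite A N'] {f : N →ₗ[A] N'}
    (hf : Function.Injective f) (h : ∀ i, Function.Bijective (post (ResidueField A) i f)) :
    Function.Surjective f := by
  have hs := IsShortExact.of_range hf
  rw [← LinearMap.range_eq_top, ← Submodule.Quotient.subsingleton_iff]
  refine subsingleton_of_ext_residueField_subsingleton (A := A) fun i _ ↦ ?_
  refine subsingleton_of_forall_eq 0 fun y ↦ ?_
  have hy : hs.postδ (ResidueField A) i y = 0 :=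
    (h (i + 1)).1 (((hs.post_exact₁ _ i).apply_apply_eq_zero y).trans (map_zero _).symm)
  obtain ⟨z, rfl⟩ := (hs.post_exact₃ _ i y).mp hy
  obtain ⟨w, rfl⟩ := (h i).2 z
  exact (hs.post_exact₂ _ i).apply_apply_eq_zero w

lemma pre_injective_of_supportDim_nonpos
    (hω : ∀ i < d, Subsingleton (ExtM A (ResidueField A) ω i))
    {M' M'' : Type u} [AddCommGroup M'] [Module A M'] [AddCommGroup M''] [Module A M'']
    {f : M →ₗ[A] M'} {g : M' →ₗ[A] M''} (h : IsShortExact f g)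
    (hM : Module.supportDim A M ≤ 0) : Function.Injective (pre ω d g) := by
  match d with
  | 0 => exact h.pre_injective_zero ω
  | d + 1 =>
    refine injective_of_exact (h.pre_exact₃ ω d) (ext_subsingleton_of_residueField fun j hj ↦ ?_)
    obtain rfl : j = 0 := by simpa using hj.trans hM
    exact hω d (Nat.lt_succ_self d)

namespace IsCanonicalModule

variable {ω ω' : Type u} [AddCommGroup ω] [Module A ω] [AddCommGroup ω'] [Module A ω'] {d : ℕ}

omit [IsNoetherianRing A] in
lemma ext_subsingleton (hω : IsCanonicalModule A ω) (hd : (d : WithBot ℕ∞) = ringKrullDim A)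
    {i : ℕ} (hi : i ≠ d) : Subsingleton (ExtM A (ResidueField A) ω i) :=
  hω.ext_eq_zero i fun h ↦ hi (by rw [← hd] at h; exact_mod_cast h)

omit [IsNoetherianRing A] in
lemma ext_nontrivial (hω : IsCanonicalModule A ω) (hd : (d : WithBot ℕ∞) = ringKrullDim A) :
    Nontrivial (ExtM A (ResidueField A) ω d) :=
  (hω.ext_dim d hd).some.toEquiv.nontrivial

lemma isWeaklyRegular (hω : IsCanonicalModule A ω) {rs : List A}
    (hrs : ∀ r ∈ rs, r ∈ maximalIdeal A) (reg : IsWeaklyRegular A rs) : IsWeaklyRegular ω rs := by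
  have := hω.finite
  refine isWeaklyRegular_of_ext_residueField (B := A) ?_ (fun j hj ↦ hω.ext_eq_zero j ?_) hrs reg
  · exact fun p _ ↦ Module.mem_support_iff_of_finite.mpr
      ((Module.annihilator_eq_bot.mpr inferInstance).trans_le bot_le)
  · rw [Module.supportDim_self_eq_ringKrullDim, ENat.WithBot.add_one_le_iff] at hj
    exact hj.ne

lemma exists_post_ne_zero (hω : IsCanonicalModule A ω) (hω' : IsCanonicalModule A ω')
    {rs : List A} (hrs : ∀ r ∈ rs, r ∈ maximalIdeal A) (reg : IsWeaklyRegular A rs)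
    (hd : (rs.length : WithBot ℕ∞) = ringKrullDim A) :
    ∃ f : ω' →ₗ[A] ω, post (ResidueField A) rs.length f ≠ 0 := by
  have := hω.finite
  have := hω'.finite
  have := hω.ext_nontrivial hd
  have := hω'.ext_nontrivial hd
  obtain ⟨η, hη⟩ := exists_ne (0 : ExtM A (ResidueField A) ω' rs.length)
  obtain ⟨c, hc⟩ := exists_ne (0 : ExtM A (ResidueField A) ω rs.length)
  obtain ⟨ζ, hζ⟩ := exists_comp_eq (fun i hi ↦ hω.ext_subsingleton hd hi.ne') hrs
    (hω'.isWeaklyRegular hrs reg) (add_zero _) hη c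
  obtain ⟨f, rfl⟩ := zeroEquiv.symm.surjective ζ
  exact ⟨f, fun h ↦ hc (hζ.symm.trans (LinearMap.congr_fun h η))⟩

theorem nonempty_linearEquiv (hA : IsCohenMacaulayLocal A) (hω : IsCanonicalModule A ω)
    (hω' : IsCanonicalModule A ω') : Nonempty (ω' ≃ₗ[A] ω) := by
  obtain ⟨-, rs, hrs, ⟨reg, -⟩, hd⟩ := hA
  have := hω.finite
  have := hω'.finite
  obtain ⟨f, hf⟩ := hω.exists_post_ne_zero hω' hrs reg hd
  have hbij (i : ℕ) : Function.Bijective (post (ResidueField A) i f) := by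
    obtain rfl | hi := eq_or_ne i rs.length
    · have := isSimpleModule_residueField A
      have := IsSimpleModule.congr (hω.ext_dim _ hd).some
      have := IsSimpleModule.congr (hω'.ext_dim _ hd).some
      exact (LinearMap.bijective_or_eq_zero _).resolve_right hf
    · have := hω.ext_subsingleton hd hi
      have := hω'.ext_subsingleton hd hi
      exact ⟨Function.injective_of_subsingleton _, fun y ↦ ⟨0, Subsingleton.elim _ _⟩⟩
  have inj : Function.Injective f := injective_of_post_length_injective hrs
    (hω'.isWeaklyRegular hrs reg) (hω.isWeaklyRegular hrs reg)
    (hd ▸ Module.supportDim_le_ringKrullDim A ω')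
    (fun i hi ↦ hω'.ext_subsingleton hd hi.ne) (hbij _).1
  exact ⟨.ofBijective f ⟨inj, surjective_of_post_bijective inj hbij⟩⟩

lemma pre_surjective (hω : IsCanonicalModule A ω) (hd : (d : WithBot ℕ∞) = ringKrullDim A)
    {M M' M'' : Type u} [AddCommGroup M] [Module A M] [AddCommGroup M'] [Module A M']
    [AddCommGroup M''] [Module A M''] [Module.Finite A M'']
    {f : M →ₗ[A] M'} {g : M' →ₗ[A] M''} (h : IsShortExact f g) :
    Function.Surjective (pre ω d f) :=
  have := hω.finite
  surjective_of_exact (h.pre_exact₁ ω d) (ext_subsingleton_of_residueField fun j _ ↦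
    hω.ext_subsingleton hd (by omega))

lemma nontrivial_ext (hω : IsCanonicalModule A ω) (hd : (d : WithBot ℕ∞) = ringKrullDim A)
    {M : Type u} [AddCommGroup M] [Module A M] [Module.Finite A M] [Nontrivial M]
    (hM : Module.supportDim A M ≤ 0) : Nontrivial (ExtM A M ω d) := by
  have := hω.finite
  have := hω.ext_nontrivial hd
  obtain ⟨f, hf⟩ := exists_surjective_residueField A M
  have hker := (Module.supportDim_le_of_injective (R := A) _
    (LinearMap.ker f).injective_subtype).trans hM
  exact (pre_injective_of_supportDim_nonpos (fun i hi ↦ hω.ext_subsingleton hd hi.ne)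
    (.of_ker hf) hker).nontrivial

lemma annihilator_ext_le (hω : IsCanonicalModule A ω) (hd : (d : WithBot ℕ∞) = ringKrullDim A)
    {M : Type u} [AddCommGroup M] [Module A M] [Module.Finite A M]
    (hM : Module.supportDim A M ≤ 0) :
    Module.annihilator A (ExtM A M ω d) ≤ Module.annihilator A M := by
  have := hω.finite
  intro r hr
  let ρ : M →ₗ[A] M := r • LinearMap.id
  have hdim (L : Submodule A M) : Module.supportDim A L ≤ 0 :=
    (Module.supportDim_le_of_injective (R := A) _ L.injective_subtype).trans hM
  have hρ : pre ω d ρ.rangeRestrict ∘ₗ pre ω d ρ.range.subtype = 0 := by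
    rw [← pre_comp]
    exact LinearMap.ext fun x ↦ (pre_smul_id d r x).trans (Module.mem_annihilator.mp hr x)
  by_contra hrM
  have : Nontrivial ρ.range := by
    rw [Submodule.nontrivial_iff_ne_bot, ne_eq, LinearMap.range_eq_bot]
    exact fun h ↦ hrM (Module.mem_annihilator.mpr (LinearMap.congr_fun h))
  have := hω.nontrivial_ext hd (hdim ρ.range)
  obtain ⟨y, hy⟩ := exists_ne (0 : ExtM A ρ.range ω d)
  obtain ⟨x, rfl⟩ := hω.pre_surjective hd (.of_range ρ.range.injective_subtype) y
  refine hy (pre_injective_of_supportDim_nonpos (fun i hi ↦ hω.ext_subsingleton hd hi.ne)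
    (.of_ker ρ.surjective_rangeRestrict) (hdim _) ?_)
  exact (LinearMap.congr_fun hρ x).trans (map_zero _).symm

/-- An element killing `ω` kills `Extᵈ(A ⧸ 𝔪ᵗ, ω)`, hence lies in every power of `𝔪`. -/
theorem annihilator_eq_bot (hω : IsCanonicalModule A ω) : Module.annihilator A ω = ⊥ := by
  obtain ⟨d, hd⟩ := exists_natCast_eq_ringKrullDim A
  rw [eq_bot_iff, ← Ideal.iInf_pow_eq_bot_of_isLocalRing (maximalIdeal A) Ideal.IsPrime.ne_top']
  refine le_iInf fun t ↦ ?_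
  have hann := Ideal.annihilator_quotient (I := maximalIdeal A ^ t)
  calc Module.annihilator A ω
      ≤ Module.annihilator A (ExtM A (A ⧸ maximalIdeal A ^ t) ω d) := annihilator_le_right d
    _ ≤ Module.annihilator A (A ⧸ maximalIdeal A ^ t) :=
      hω.annihilator_ext_le hd (supportDim_nonpos_of_maximalIdeal_pow_le hann.ge)
    _ = maximalIdeal A ^ t := hann

end IsCanonicalModule

end CanonicalModule

section RegularLocalRing

open ExtM Pointwise RingTheory.Sequence

lemma mem_span_image_erase_of_sum_mul_eq_zero {B ι : Type*} [CommRing B] [DecidableEq ι]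
    {s : Finset ι} {a f : ι → B} (h : ∑ i ∈ s, a i * f i = 0) {j : ι} (hj : j ∈ s)
    (ha : IsUnit (a j)) : f j ∈ Ideal.span (f '' (s.erase j)) := by
  rw [← Finset.add_sum_erase s _ hj, add_eq_zero_iff_eq_neg] at h
  rw [← Ideal.unit_mul_mem_iff_mem _ ha, h]
  exact neg_mem (sum_mem fun i hi ↦
    Ideal.mul_mem_left _ _ (Ideal.subset_span (Set.mem_image_of_mem f hi)))

lemma spanFinrank_maximalIdeal_quotient_lt {S : Type*} [CommRing S] [IsLocalRing S]
    [IsNoetherianRing S] {x : S} [IsLocalRing (S ⧸ Ideal.span {x})] (hx : x ∈ maximalIdeal S)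
    (hx2 : x ∉ maximalIdeal S ^ 2) :
    (maximalIdeal (S ⧸ Ideal.span {x})).spanFinrank < (maximalIdeal S).spanFinrank := by
  classical
  obtain ⟨s, hcard, hs⟩ := Submodule.FG.exists_span_finset_card_eq_spanFinrank
    (IsNoetherian.noetherian (maximalIdeal S))
  have hx' := hx
  rw [← hs] at hx'
  obtain ⟨a, -, ha⟩ := Submodule.mem_span_finset.mp hx'
  obtain ⟨y, hy, hay⟩ : ∃ y ∈ s, IsUnit (a y) := by
    by_contra! hc
    refine hx2 (ha ▸ ?_)
    rw [pow_two]
    exact sum_mem fun y hy ↦ Ideal.mul_mem_mul (hc y hy) (hs ▸ Ideal.subset_span hy)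
  let π := Ideal.Quotient.mk (Ideal.span {x})
  have hsum : ∑ z ∈ s, π (a z) * π z = 0 := by
    simp only [← map_mul, ← map_sum]
    exact Ideal.Quotient.eq_zero_iff_mem.mpr (ha ▸ Ideal.mem_span_singleton_self x)
  have hmax : maximalIdeal (S ⧸ Ideal.span {x}) = Ideal.span (π '' (s.erase y)) := by
    rw [← map_maximalIdeal_of_surjective π Ideal.Quotient.mk_surjective, ← hs,
      Ideal.submodule_span_eq, Ideal.map_span, ← Finset.insert_erase hy, Finset.coe_insert,
      Set.image_insert_eq, Finset.erase_insert (Finset.notMem_erase y s)]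
    exact Submodule.span_insert_eq_span
      (mem_span_image_erase_of_sum_mul_eq_zero hsum hy (hay.map π))
  calc (maximalIdeal (S ⧸ Ideal.span {x})).spanFinrank
      ≤ (π '' (s.erase y)).ncard := hmax ▸ Submodule.spanFinrank_span_le_ncard_of_finite
        ((Finset.finite_toSet _).image _)
    _ ≤ (s.erase y).card := (Set.ncard_image_le (Finset.finite_toSet _)).trans_eq
        (Set.ncard_coe_finset _)
    _ < (maximalIdeal S).spanFinrank := hcard ▸ Finset.card_erase_lt_of_mem hy

lemma isRegularLocalRing_quotient_span_singleton {S : Type*} [CommRing S] [IsRegularLocalRing S]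
    {x : S} [IsLocalRing (S ⧸ Ideal.span {x})] (hx : x ∈ maximalIdeal S)
    (hx2 : x ∉ maximalIdeal S ^ 2) : IsRegularLocalRing (S ⧸ Ideal.span {x}) := by
  refine IsRegularLocalRing.of_spanFinrank_maximalIdeal_le _ ?_
  have hrank : (((maximalIdeal (S ⧸ Ideal.span {x})).spanFinrank + 1 : ℕ) : WithBot ℕ∞) ≤
      ringKrullDim S := by
    rw [← (isRegularLocalRing_iff S).mp inferInstance]
    exact_mod_cast spanFinrank_maximalIdeal_quotient_lt hx hx2
  have hdim := ringKrullDim_le_ringKrullDim_quotient_add_card {x} (R := S)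
    (by simpa [ringJacobson_eq_maximalIdeal] using hx)
  rw [Finset.coe_singleton, Finset.card_singleton] at hdim
  exact ENat.WithBot.add_le_add_one_right_iff.mp (by exact_mod_cast hrank.trans hdim)

lemma exists_mem_maximalIdeal_notMem_minimalPrimes {S : Type*} [CommRing S] [IsLocalRing S]
    [IsNoetherianRing S] (hS : ¬ IsField S) (hmin : maximalIdeal S ∉ minimalPrimes S) :
    ∃ x ∈ maximalIdeal S, x ∉ maximalIdeal S ^ 2 ∧ ∀ p ∈ minimalPrimes S, x ∉ p := by
  by_contra! h
  have hsub : (maximalIdeal S : Set S) ⊆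
      ⋃ p ∈ insert (maximalIdeal S ^ 2) (minimalPrimes S), (p : Set S) := by
    intro x hx
    simp only [Set.mem_iUnion, exists_prop]
    by_cases hx2 : x ∈ maximalIdeal S ^ 2
    · exact ⟨_, Set.mem_insert _ _, hx2⟩
    · obtain ⟨p, hp, hxp⟩ := h x hx hx2
      exact ⟨p, Set.mem_insert_of_mem _ hp, hxp⟩
  obtain ⟨p, rfl | hp, hle⟩ := (Ideal.subset_union_prime_finite (f := id)
    ((minimalPrimes.finite_of_isNoetherianRing S).insert _) (maximalIdeal S ^ 2)
    (maximalIdeal S ^ 2) (fun p hp hne _ ↦ (hp.resolve_left hne).1.1)).mp hsub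
  · refine hS (isField_iff_maximalIdeal_eq.mpr (Submodule.eq_bot_of_le_smul_of_le_jacobson_bot
      (maximalIdeal S) _ (IsNoetherian.noetherian _) ?_ (maximalIdeal_le_jacobson _)))
    simpa [pow_two] using hle
  · exact hmin (le_antisymm (le_maximalIdeal hp.1.1.ne_top) hle ▸ hp)

lemma maximalIdeal_notMem_minimalPrimes {S : Type*} [CommRing S] [IsRegularLocalRing S]
    (hS : ¬ IsField S) : maximalIdeal S ∉ minimalPrimes S := by
  intro h
  have hrank := (isRegularLocalRing_iff S).mp inferInstance
  rw [← maximalIdeal_height_eq_ringKrullDim, Ideal.height_eq_zero_iff.mpr h] at hrank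
  refine hS (isField_iff_maximalIdeal_eq.mpr ?_)
  rw [← Submodule.spanFinrank_eq_zero_iff_eq_bot (IsNoetherian.noetherian _)]
  exact_mod_cast hrank

lemma isDomain_of_isPrime_span_singleton {S : Type*} [CommRing S] [IsLocalRing S]
    [IsNoetherianRing S] {x : S} (hx : x ∈ maximalIdeal S) (hmin : ∀ p ∈ minimalPrimes S, x ∉ p)
    (hprime : (Ideal.span {x}).IsPrime) : IsDomain S := by
  obtain ⟨p, hp, hpx⟩ := Ideal.exists_minimalPrimes_le (bot_le : ⊥ ≤ Ideal.span {x})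
  have := hp.isPrime
  obtain rfl : p = ⊥ := by
    refine Submodule.eq_bot_of_le_smul_of_le_jacobson_bot (Ideal.span {x}) p
      (IsNoetherian.noetherian _) (fun q hq ↦ ?_)
      ((Ideal.span_singleton_le_iff_mem _).mpr (maximalIdeal_le_jacobson _ hx))
    obtain ⟨a, rfl⟩ := Ideal.mem_span_singleton.mp (hpx hq)
    exact Ideal.mul_mem_mul (Ideal.mem_span_singleton_self x)
      ((this.mem_or_mem hq).resolve_left (hmin p hp))
  exact IsDomain.of_bot_isPrime S

theorem regularLocalRing_induction {motive : (S : Type u) → [CommRing S] → Prop}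
    (field : ∀ (S : Type u) [CommRing S], IsField S → motive S)
    (quotient : ∀ (S : Type u) [CommRing S] [IsRegularLocalRing S] (x : S), x ∈ maximalIdeal S →
      (∀ p ∈ minimalPrimes S, x ∉ p) → motive (S ⧸ Ideal.span {x}) → motive S)
    (S : Type u) [CommRing S] [IsRegularLocalRing S] : motive S := by
  induction hr : (maximalIdeal S).spanFinrank using Nat.strong_induction_on generalizing S with
  | _ r ih =>
  by_cases hS : IsField S
  · exact field S hS
  obtain ⟨x, hx, hx2, hmin⟩ :=
    exists_mem_maximalIdeal_notMem_minimalPrimes hS (maximalIdeal_notMem_minimalPrimes hS)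
  have : Nontrivial (S ⧸ Ideal.span {x}) := Ideal.Quotient.nontrivial_iff.mpr
    (mt Ideal.span_singleton_eq_top.mp hx)
  have : IsLocalRing (S ⧸ Ideal.span {x}) :=
    .of_surjective' (Ideal.Quotient.mk _) Ideal.Quotient.mk_surjective
  have := isRegularLocalRing_quotient_span_singleton hx hx2
  exact quotient S x hx hmin
    (ih _ (hr ▸ spanFinrank_maximalIdeal_quotient_lt hx hx2) _ rfl)

theorem isDomain_of_isRegularLocalRing (S : Type u) [CommRing S] [IsRegularLocalRing S] :
    IsDomain S :=
  regularLocalRing_induction (motive := fun S _ ↦ IsDomain S) (fun _ _ hS ↦ hS.isDomain)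
    (fun _ _ _ _ hx hmin ih ↦ isDomain_of_isPrime_span_singleton hx hmin
      ((Ideal.Quotient.isDomain_iff_prime _).mp ih)) S

lemma exists_isWeaklyRegular_ofList_eq_of_quotient {S : Type*} [CommRing S] {x : S}
    (hx : IsSMulRegular S x) {J : Ideal S} (hxJ : x ∈ J) {rs : List (S ⧸ Ideal.span {x})}
    (reg : IsWeaklyRegular (S ⧸ Ideal.span {x}) rs)
    (hrs : Ideal.ofList rs = J.map (Ideal.Quotient.mk (Ideal.span {x}))) :
    ∃ rs : List S, IsWeaklyRegular S rs ∧ Ideal.ofList rs = J := by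
  obtain ⟨rs, rfl⟩ := List.map_surjective_iff.mpr Ideal.Quotient.mk_surjective rs
  refine ⟨x :: rs, (isWeaklyRegular_cons_iff S x rs).mpr ⟨hx, ?_⟩, ?_⟩
  · have hs : x • (⊤ : Ideal S) = Ideal.span {x} := by
      rw [← Submodule.ideal_span_singleton_smul, smul_eq_mul, Ideal.mul_top]
    exact ((Submodule.quotEquivOfEq _ _ hs).isWeaklyRegular_congr rs).mpr
      ((isWeaklyRegular_map_algebraMap_iff _ _ rs).mp reg)
  · rw [← Ideal.map_ofList] at hrs
    have h := congrArg (Ideal.comap (Ideal.Quotient.mk (Ideal.span {x}))) hrs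
    rw [Ideal.comap_map_of_surjective' _ Ideal.Quotient.mk_surjective,
      Ideal.comap_map_of_surjective' _ Ideal.Quotient.mk_surjective, Ideal.mk_ker] at h
    rw [Ideal.ofList_cons, sup_comm, h]
    exact sup_eq_left.mpr ((Ideal.span_singleton_le_iff_mem _).mpr hxJ)

theorem exists_isWeaklyRegular_ofList_eq_maximalIdeal (S : Type u) [CommRing S]
    [IsRegularLocalRing S] :
    ∃ rs : List S, IsWeaklyRegular S rs ∧ Ideal.ofList rs = maximalIdeal S := by
  refine regularLocalRing_induction (motive := fun S _ ↦ ∀ _ : IsLocalRing S, ∃ rs : List S,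
    IsWeaklyRegular S rs ∧ Ideal.ofList rs = maximalIdeal S) ?_ ?_ S _
  · exact fun S _ hS _ ↦ ⟨[], .nil S S, by
      rw [Ideal.ofList_nil, isField_iff_maximalIdeal_eq.mp hS]⟩
  · intro S _ _ x hx hmin ih _
    have := isDomain_of_isRegularLocalRing S
    have hx0 : x ≠ 0 := by
      rintro rfl
      obtain ⟨p, hp⟩ := Ideal.nonempty_minimalPrimes (I := (⊥ : Ideal S)) bot_ne_top
      exact hmin p hp (zero_mem p)
    have : Nontrivial (S ⧸ Ideal.span {x}) := Ideal.Quotient.nontrivial_iff.mpr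
      (mt Ideal.span_singleton_eq_top.mp hx)
    have : IsLocalRing (S ⧸ Ideal.span {x}) :=
      .of_surjective' (Ideal.Quotient.mk _) Ideal.Quotient.mk_surjective
    obtain ⟨rs, reg, hrs⟩ := ih this
    refine exists_isWeaklyRegular_ofList_eq_of_quotient
      (fun a b hab ↦ mul_left_cancel₀ hx0 hab) hx reg (hrs.trans ?_)
    exact (map_maximalIdeal_of_surjective _ Ideal.Quotient.mk_surjective).symm

/-- The modules `Extⁱ(M, C)` are concentrated in degree `j`, where they are isomorphic to `M`.
This condition is inherited, in degree `j + 1`, by the quotient of `M` by an `M`-regular element. -/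
structure IsExtSelfDual {A : Type u} [CommRing A] (M C : Type u) [AddCommGroup M] [Module A M]
    [AddCommGroup C] [Module A C] (j : ℕ) : Prop where
  subsingleton : ∀ i, i ≠ j → Subsingleton (ExtM A M C i)
  nonempty_linearEquiv : Nonempty (ExtM A M C j ≃ₗ[A] M)

namespace IsExtSelfDual

variable {A M M' C : Type u} [CommRing A] [AddCommGroup M] [Module A M] [AddCommGroup M']
  [Module A M'] [AddCommGroup C] [Module A C] {j : ℕ}

lemma self (A : Type u) [CommRing A] : IsExtSelfDual (A := A) A A 0 where
  subsingleton i hi := by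
    obtain ⟨i, rfl⟩ := Nat.exists_eq_succ_of_ne_zero hi
    exact subsingleton_of_projective i
  nonempty_linearEquiv := ⟨zeroEquiv.trans (LinearMap.ringLmapEquivSelf A A A)⟩

lemma congr (h : IsExtSelfDual (A := A) M C j) (e : M ≃ₗ[A] M') :
    IsExtSelfDual (A := A) M' C j where
  subsingleton i hi :=
    have := h.subsingleton i hi
    (congrLeft e C i).symm.toEquiv.subsingleton
  nonempty_linearEquiv :=
    ⟨(congrLeft e C j).symm.trans (h.nonempty_linearEquiv.some.trans e)⟩

lemma quotSMulTop (h : IsExtSelfDual (A := A) M C j) {x : A} (reg : IsSMulRegular M x) :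
    IsExtSelfDual (A := A) (QuotSMulTop x M) C (j + 1) := by
  have hs := IsShortExact.of_isSMulRegular reg
  obtain ⟨e⟩ := h.nonempty_linearEquiv
  have hinj (i : ℕ) : Function.Injective (pre C i (x • LinearMap.id : M →ₗ[A] M)) := by
    obtain rfl | hi := eq_or_ne i j
    · intro y z hyz
      simp only [pre_smul_id] at hyz
      exact (e.isSMulRegular_congr x).mpr reg hyz
    · have := h.subsingleton i hi
      exact Function.injective_of_subsingleton _
  have hpre (i : ℕ) (y) : pre C i (x • (⊤ : Submodule A M)).mkQ y = 0 :=
    hinj i (((hs.pre_exact₂ C i).apply_apply_eq_zero y).trans (map_zero _).symm)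
  refine ⟨fun i hi ↦ subsingleton_of_forall_eq 0 fun y ↦ ?_, ?_⟩
  · match i with
    | 0 => exact hs.pre_injective_zero C ((hpre 0 y).trans (map_zero _).symm)
    | i + 1 =>
      obtain ⟨z, rfl⟩ := (hs.pre_exact₃ C i y).mp (hpre _ y)
      rw [(h.subsingleton i (by omega)).elim z 0, map_zero]
  · have hrange : LinearMap.range (pre C j (x • LinearMap.id : M →ₗ[A] M)) = x • ⊤ := by
      ext y
      simp [Submodule.mem_smul_pointwise_iff_exists]
    have hsurj := fun y ↦ (hs.pre_exact₃ C j y).mp (hpre _ y)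
    exact ⟨((hs.pre_exact₁ C j).linearEquivOfSurjective hsurj).symm.trans
      ((Submodule.quotEquivOfEq _ _ hrange).trans (QuotSMulTop.congr x e))⟩

lemma quotient_ofList_smul_top (h : IsExtSelfDual (A := A) M C j) {rs : List A}
    (reg : IsWeaklyRegular M rs) :
    IsExtSelfDual (A := A) (M ⧸ (Ideal.ofList rs • ⊤ : Submodule A M)) C (j + rs.length) := by
  induction rs generalizing M j with
  | nil => exact h.congr (Submodule.quotEquivOfEqBot _ (by simp)).symm
  | cons x rs ih =>
    rw [isWeaklyRegular_cons_iff] at reg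
    rw [List.length_cons, add_comm rs.length 1, ← add_assoc]
    exact (ih (h.quotSMulTop reg.1) reg.2).congr
      (Submodule.quotOfListConsSMulTopEquivQuotSMulTopInner M x rs).symm

end IsExtSelfDual

theorem isCanonicalModule_self_of_isRegularLocalRing (S : Type u) [CommRing S]
    [IsRegularLocalRing S] : IsCanonicalModule S S := by
  obtain ⟨rs, reg, hrs⟩ := exists_isWeaklyRegular_ofList_eq_maximalIdeal S
  have htop : Ideal.ofList rs • ⊤ = maximalIdeal S := by rw [hrs, smul_eq_mul, Ideal.mul_top]
  have hdim : (rs.length : WithBot ℕ∞) = ringKrullDim S := by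
    have hfield : ringKrullDim (S ⧸ maximalIdeal S) = 0 :=
      ringKrullDim_eq_zero_of_field (ResidueField S)
    have h := ringKrullDim_add_length_eq_ringKrullDim_of_isRegular rs
      ⟨reg, htop ▸ (Ideal.IsPrime.ne_top inferInstance).symm⟩
    rwa [hrs, hfield, zero_add] at h
  have hdual := ((IsExtSelfDual.self S).quotient_ofList_smul_top reg).congr
    (Submodule.quotEquivOfEq _ _ htop)
  rw [zero_add] at hdual
  refine ⟨inferInstance, fun i hi ↦ hdual.subsingleton i fun h ↦ hi (h ▸ hdim), fun i hi ↦ ?_⟩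
  obtain rfl : i = rs.length := by exact_mod_cast hi.trans hdim.symm
  exact hdual.nonempty_linearEquiv

end RegularLocalRing

section FreeResolution

open ExtM

section CokerTranspose

variable {S : Type u} [CommRing S] {m n : ℕ}

lemma dotProductEquiv_comp_mulVecLin (D : Matrix (Fin m) (Fin n) S) (v : Fin m → S) :
    dotProductEquiv S (Fin m) v ∘ₗ D.mulVecLin =
      dotProductEquiv S (Fin n) (D.transpose.mulVecLin v) := by
  refine LinearMap.ext fun w ↦ ?_
  simp [Matrix.dotProduct_mulVec]

variable {D : Matrix (Fin m) (Fin n) S}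

lemma exact_mulVecLin_transpose_preδ (hD : Function.Injective D.mulVecLin) :
    Function.Exact D.transpose.mulVecLin
      ((IsShortExact.of_range hD).preδ S 0 ∘ₗ
        ((dotProductEquiv S (Fin n)).trans zeroEquiv.symm).toLinearMap) := fun w ↦ by
  rw [LinearMap.comp_apply, (IsShortExact.of_range hD).pre_exact₁ S 0]
  constructor
  · rintro ⟨y, hy⟩
    obtain ⟨v, rfl⟩ := ((dotProductEquiv S (Fin m)).trans zeroEquiv.symm).surjective y
    refine ⟨v, ((dotProductEquiv S (Fin n)).trans zeroEquiv.symm).injective ?_⟩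
    simpa [pre_zeroEquiv_symm, dotProductEquiv_comp_mulVecLin] using hy
  · rintro ⟨v, rfl⟩
    exact ⟨zeroEquiv.symm (dotProductEquiv S (Fin m) v), by
      simp [pre_zeroEquiv_symm, dotProductEquiv_comp_mulVecLin]⟩

lemma nonempty_coker_transpose_equiv_ext_one (hD : Function.Injective D.mulVecLin) :
    Nonempty (Coker D.transpose.mulVecLin ≃ₗ[S] ExtM S (Coker D.mulVecLin) S 1) := by
  refine ⟨(exact_mulVecLin_transpose_preδ hD).linearEquivOfSurjective ?_⟩
  rw [LinearMap.coe_comp]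
  exact (surjective_of_exact ((IsShortExact.of_range hD).pre_exact₃ S 0)
    (subsingleton_of_projective 0)).comp (LinearEquiv.surjective _)

end CokerTranspose

section CokerQuotient

variable {S : Type*} [CommRing S] {m n : ℕ} (I : Ideal S) (D : Matrix (Fin m) (Fin n) S)

lemma map_mk_mulVecLin (w : Fin n → S) :
    (D.map (Ideal.Quotient.mk I)).mulVecLin (Ideal.Quotient.mk I ∘ w) =
      Ideal.Quotient.mk I ∘ D.mulVecLin w :=
  funext fun i ↦ (RingHom.map_mulVec (Ideal.Quotient.mk I) D w i).symm

variable {I D}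

lemma mem_range_of_forall_mem_of_le_annihilator_coker
    (hI : I ≤ Module.annihilator S (Coker D.mulVecLin)) {v : Fin m → S} (hv : ∀ i, v i ∈ I) :
    v ∈ LinearMap.range D.mulVecLin := by
  rw [← Submodule.ker_mkQ (LinearMap.range _), LinearMap.mem_ker, pi_eq_sum_univ' v, map_sum]
  exact Finset.sum_eq_zero fun i _ ↦ Module.mem_annihilator.mp (hI (hv i)) (Submodule.Quotient.mk _)

lemma nonempty_coker_equiv_coker_map_mk
    (hI : I ≤ Module.annihilator S (Coker D.mulVecLin)) :
    Nonempty (Coker D.mulVecLin ≃ₗ[S] Coker (D.map (Ideal.Quotient.mk I)).mulVecLin) := by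
  let q : (Fin m → S) →ₗ[S] (Fin m → S ⧸ I) := (Algebra.linearMap S (S ⧸ I)).compLeft (Fin m)
  let π : (Fin m → S) →ₗ[S] Coker (D.map (Ideal.Quotient.mk I)).mulVecLin :=
    (LinearMap.range _).mkQ.restrictScalars S ∘ₗ q
  have hq : Function.Surjective q := Ideal.Quotient.mk_surjective.comp_left
  refine ⟨Function.Exact.linearEquivOfSurjective (g := π) (fun v ↦ ?_)
    ((Submodule.mkQ_surjective _).comp hq)⟩
  change Submodule.Quotient.mk (Ideal.Quotient.mk I ∘ v) = 0 ↔ _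
  rw [Submodule.Quotient.mk_eq_zero]
  constructor
  · rintro ⟨w, hw⟩
    obtain ⟨w, rfl⟩ := Ideal.Quotient.mk_surjective.comp_left w
    rw [map_mk_mulVecLin] at hw
    rw [← sub_add_cancel v (D.mulVecLin w)]
    refine add_mem (mem_range_of_forall_mem_of_le_annihilator_coker hI fun i ↦ ?_) ⟨w, rfl⟩
    exact Ideal.Quotient.eq.mp (congrFun hw i).symm
  · rintro ⟨w, rfl⟩
    exact ⟨_, map_mk_mulVecLin I D w⟩

end CokerQuotient

namespace MinimalFreeResolution

variable {S : Type u} [CommRing S] [IsLocalRing S] {I : Ideal S} {g : ℕ}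
  (G : MinimalFreeResolution I g)

/-- The `j`-th syzygy module of `S ⧸ I`, realised as the cokernel of `G_{j+1} → G_j`; thus the
zeroth one is `S ⧸ I` itself. -/
abbrev syzygy (j : ℕ) : Type u := Coker (G.d j).mulVecLin

lemma isShortExact_syzygy (j : ℕ) :
    IsShortExact ((LinearMap.range (G.d (j + 1)).mulVecLin).liftQ (G.d j).mulVecLin
        (G.exact_succ j).linearMap_ker_eq.ge)
      (LinearMap.range (G.d j).mulVecLin).mkQ where
  injective := LinearMap.ker_eq_bot.mp
    (Submodule.ker_liftQ_eq_bot _ _ _ (G.exact_succ j).linearMap_ker_eq.le)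
  surjective := Submodule.mkQ_surjective _
  exact := LinearMap.exact_iff.mpr (by rw [Submodule.ker_mkQ, Submodule.range_liftQ])

/-- The isomorphism of the zeroth syzygy module with the resolved module. -/
noncomputable def syzygyZeroEquiv : G.syzygy 0 ≃ₗ[S] S ⧸ I :=
  G.exact_zero.linearEquivOfSurjective G.augmentation_surjective

lemma nonempty_ext_syzygy_equiv (N : Type u) [AddCommGroup N] [Module S N] (j : ℕ) :
    ∀ {i n : ℕ}, i + 1 + j = n →
      Nonempty (ExtM S (G.syzygy j) N (i + 1) ≃ₗ[S] ExtM S (S ⧸ I) N n) := by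
  induction j with
  | zero =>
    rintro i _ rfl
    exact ⟨congrLeft G.syzygyZeroEquiv N (i + 1)⟩
  | succ j ih =>
    intro i n h
    obtain ⟨e⟩ := ih (i := i + 1) (n := n) (by omega)
    exact ⟨((G.isShortExact_syzygy j).shiftEquiv N i).trans e⟩

lemma isEmpty_fin_rank {j : ℕ} (hj : g < j) : IsEmpty (Fin (G.rank j)) := by
  rw [G.rank_eq_zero j hj]
  infer_instance

/-- Beyond the length of the resolution, the syzygy modules are its terms. -/
noncomputable def syzygyEquiv {j : ℕ} (hj : g ≤ j) : G.syzygy j ≃ₗ[S] (Fin (G.rank j) → S) :=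
  have := G.isEmpty_fin_rank (Nat.lt_succ_of_le hj)
  Submodule.quotEquivOfEqBot _ (LinearMap.range_eq_bot.mpr (Subsingleton.elim _ _))

lemma ext_quotient_subsingleton (G : MinimalFreeResolution I g) (N : Type u) [AddCommGroup N]
    [Module S N] {i : ℕ} (hi : g < i) :
    Subsingleton (ExtM S (S ⧸ I) N i) := by
  obtain ⟨i, rfl⟩ := Nat.exists_eq_add_of_lt hi
  obtain ⟨e⟩ := G.nonempty_ext_syzygy_equiv N g (i := i) (n := g + i + 1) (by omega)
  have := Module.Projective.of_equiv (G.syzygyEquiv le_rfl).symm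
  have : Subsingleton (ExtM S (G.syzygy g) N (i + 1)) := subsingleton_of_projective i
  exact e.symm.toEquiv.subsingleton

lemma injective_mulVecLin_d {j : ℕ} (hj : g ≤ j + 1) : Function.Injective (G.d j).mulVecLin :=
  have := G.isEmpty_fin_rank (Nat.lt_succ_of_le hj)
  injective_of_exact (G.exact_succ j) inferInstance

lemma nonempty_coker_lastMap_transpose_equiv_ext :
    Nonempty (Coker G.lastMap.transpose.mulVecLin ≃ₗ[S] ExtM S (S ⧸ I) S g) := by
  match g, G with
  | 0, G =>
    have hrange : LinearMap.range G.lastMap.transpose.mulVecLin = ⊥ :=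
      LinearMap.range_eq_bot.mpr (by simp [lastMap, diff])
    exact ⟨(Submodule.quotEquivOfEqBot _ hrange).trans ((dotProductEquiv S _).trans
      (zeroEquiv.symm.trans
        (congrLeft ((G.syzygyEquiv le_rfl).symm.trans G.syzygyZeroEquiv) S 0)))⟩
  | j + 1, G =>
    obtain ⟨e⟩ := nonempty_coker_transpose_equiv_ext_one (G.injective_mulVecLin_d le_rfl)
    obtain ⟨e'⟩ := G.nonempty_ext_syzygy_equiv S j (i := 0) (n := j + 1) (by omega)
    exact ⟨e.trans e'⟩

theorem nonempty_ext_quotient_equiv_coker :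
    Nonempty (ExtM S (S ⧸ I) S g ≃ₗ[S] Coker G.lastMapTransposeQuot.mulVecLin) := by
  obtain ⟨e⟩ := G.nonempty_coker_lastMap_transpose_equiv_ext
  have hI : I ≤ Module.annihilator S (Coker G.lastMap.transpose.mulVecLin) := by
    rw [e.annihilator_eq]
    exact Ideal.annihilator_quotient.ge.trans (annihilator_le_left g)
  obtain ⟨e'⟩ := nonempty_coker_equiv_coker_map_mk hI
  exact ⟨e.symm.trans e'⟩

end MinimalFreeResolution

end FreeResolution

section ChangeOfRings

open ExtM

variable {S R C W : Type u} [CommRing S] [CommRing R] [Algebra S R]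
  [AddCommGroup C] [Module S C] [AddCommGroup W] [Module S W] [Module R W] [IsScalarTower S R W]
  {M M' M'' : Type u} [AddCommGroup M] [Module S M] [Module R M] [IsScalarTower S R M]
  [AddCommGroup M'] [Module S M'] [Module R M'] [IsScalarTower S R M']
  [AddCommGroup M''] [Module S M''] [Module R M''] [IsScalarTower S R M'']

lemma IsShortExact.restrictScalars {f : M →ₗ[R] M'} {g : M' →ₗ[R] M''} (h : IsShortExact f g) :
    IsShortExact (f.restrictScalars S) (g.restrictScalars S) :=
  ⟨h.injective, h.surjective, h.exact⟩

lemma exists_bijective_of_ker_iff {S R B D B' D' : Type*} [CommRing S] [CommRing R]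
    {σ : S →+* R} [AddCommGroup B] [AddCommGroup D] [AddCommGroup B'] [AddCommGroup D']
    [Module S B] [Module S D] [Module R B'] [Module R D'] {δ : B →ₗ[S] D} {δ' : B' →ₗ[R] D'}
    (hδ : Function.Surjective δ) (hδ' : Function.Surjective δ') {f : B →ₛₗ[σ] B'}
    (hf : Function.Surjective f) (hker : ∀ b, δ b = 0 ↔ δ' (f b) = 0) :
    ∃ f' : D →ₛₗ[σ] D', Function.Bijective f' := by
  let F : (B ⧸ LinearMap.ker δ) →ₛₗ[σ] D' :=
    (LinearMap.ker δ).liftQ (δ'.comp f) fun b hb ↦ (hker b).mp hb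
  have hF : Function.Bijective F := by
    constructor
    · exact LinearMap.ker_eq_bot.mp
        (Submodule.ker_liftQ_eq_bot _ _ _ fun b hb ↦ (hker b).mpr hb)
    · refine fun d ↦ ?_
      obtain ⟨b, rfl⟩ := (hδ'.comp hf) d
      exact ⟨Submodule.Quotient.mk b, rfl⟩
  exact ⟨F.comp (δ.quotKerEquivOfSurjective hδ).symm.toLinearMap,
    hF.comp (LinearEquiv.bijective _)⟩

/-- The `S`-linear family of maps `R → M`, `1 ↦ m`, parametrised by `m`. -/
def spanMap (S R M : Type u) [CommRing S] [CommRing R] [Algebra S R] [AddCommGroup M] [Module S M]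
    [Module R M] [IsScalarTower S R M] : M →ₗ[S] R →ₗ[S] M :=
  (Algebra.lsmul S S M).toLinearMap.flip

@[simp]
lemma spanMap_apply (m : M) (r : R) : spanMap S R M m r = r • m := rfl

lemma comp_spanMap (f : M →ₗ[R] M') (m : M) :
    f.restrictScalars S ∘ₗ spanMap S R M m = spanMap S R M' (f m) := by
  ext
  simp

lemma sum_pre_proj_pre_spanMap {n j : ℕ} (ξ : ExtM S (Fin n → R) C j) :
    ∑ i, pre C j (LinearMap.proj i) (pre C j (spanMap S R _ (Pi.single i 1)) ξ) = ξ := by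
  have hid : ∑ i, spanMap S R (Fin n → R) (Pi.single i 1) ∘ₗ LinearMap.proj i =
      (LinearMap.id : (Fin n → R) →ₗ[S] (Fin n → R)) := by
    refine LinearMap.ext fun v ↦ ?_
    simp [LinearMap.sum_apply, ← pi_eq_sum_univ' v]
  conv_rhs => rw [← LinearMap.id_apply (R := S) ξ, ← pre_id, ← hid]
  simp [pre_comp, LinearMap.sum_apply]

lemma ext_pi_subsingleton {j : ℕ} (h : Subsingleton (ExtM S R C j)) (n : ℕ) :
    Subsingleton (ExtM S (Fin n → R) C j) :=
  subsingleton_of_forall_eq 0 fun ξ ↦ by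
    rw [← sum_pre_proj_pre_spanMap ξ]
    exact Finset.sum_eq_zero fun i _ ↦ by rw [h.elim (pre C j _ ξ) 0, map_zero]

lemma ext_subsingleton_of_lt [IsNoetherianRing R] {g : ℕ}
    (hR : ∀ j < g, Subsingleton (ExtM S R C j)) {j : ℕ} (hj : j < g) :
    ∀ (M : Type u) [AddCommGroup M] [Module S M] [Module R M] [IsScalarTower S R M]
      [Module.Finite R M], Subsingleton (ExtM S M C j) := by
  induction j with
  | zero =>
    intro M _ _ _ _ _
    obtain ⟨n, q, hq⟩ := Module.Finite.exists_fin' R M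
    have := ext_pi_subsingleton (hR 0 hj) n
    exact ((IsShortExact.of_ker hq).restrictScalars.pre_injective_zero C).subsingleton
  | succ j ih =>
    intro M _ _ _ _ _
    obtain ⟨n, q, hq⟩ := Module.Finite.exists_fin' R M
    exact subsingleton_of_exact ((IsShortExact.of_ker hq).restrictScalars.pre_exact₃ C j)
      (ih (by omega) _) (ext_pi_subsingleton (hR _ hj) n)

variable {g : ℕ} (hsurj : Function.Surjective (algebraMap S R)) (ε : ExtM S R C g ≃ₗ[S] W)

/-- The natural map `Ext_S^g(M, C) → Hom_R(M, Ext_S^g(R, C))`. -/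
noncomputable def extToHom (M : Type u) [AddCommGroup M] [Module S M] [Module R M]
    [IsScalarTower S R M] : ExtM S M C g →ₛₗ[algebraMap S R] (M →ₗ[R] W) where
  toFun ξ := LinearMap.extendScalarsOfSurjective hsurj
    (ε.toLinearMap ∘ₗ (pre C g).flip ξ ∘ₗ spanMap S R M)
  map_add' ξ ξ' := by
    ext
    simp
  map_smul' s ξ := by
    ext
    simp

lemma extToHom_apply (ξ : ExtM S M C g) (m : M) :
    extToHom hsurj ε M ξ m = ε (pre C g (spanMap S R M m) ξ) := rfl

lemma extToHom_pre (f : M →ₗ[R] M') (ξ : ExtM S M' C g) :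
    extToHom hsurj ε M (pre C g (f.restrictScalars S) ξ) = extToHom hsurj ε M' ξ ∘ₗ f := by
  ext m
  simp only [LinearMap.comp_apply, extToHom_apply, ← comp_spanMap, pre_comp]

lemma extToHom_self_symm_apply (w : W) (r : R) :
    extToHom hsurj ε R (ε.symm w) r = r • w := by
  have h1 : spanMap S R R 1 = LinearMap.id := LinearMap.ext mul_one
  rw [← mul_one r, ← smul_eq_mul, map_smul, extToHom_apply, h1, pre_id, LinearMap.id_apply,
    LinearEquiv.apply_symm_apply, smul_eq_mul, mul_one]

lemma extToHom_pi_bijective (n : ℕ) :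
    Function.Bijective (extToHom hsurj ε (Fin n → R)) := by
  constructor
  · refine (injective_iff_map_eq_zero _).mpr fun ξ hξ ↦ ?_
    rw [← sum_pre_proj_pre_spanMap ξ]
    refine Finset.sum_eq_zero fun i _ ↦ ?_
    have hi : ε (pre C g (spanMap S R _ (Pi.single i 1)) ξ) = 0 := by
      rw [← extToHom_apply hsurj, hξ, LinearMap.zero_apply]
    rw [(LinearEquiv.map_eq_zero_iff _).mp hi, map_zero]
  · intro f
    refine ⟨∑ i, pre C g ((LinearMap.proj (R := R) i).restrictScalars S)
      (ε.symm (f (Pi.single i 1))), LinearMap.ext fun v ↦ ?_⟩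
    conv_rhs => rw [pi_eq_sum_univ' v, map_sum]
    simp [extToHom_pre, extToHom_self_symm_apply, LinearMap.sum_apply]

variable [IsNoetherianRing R]

lemma extToHom_injective (hR : ∀ j < g, Subsingleton (ExtM S R C j))
    (M : Type u) [AddCommGroup M] [Module S M] [Module R M]
    [IsScalarTower S R M] [Module.Finite R M] : Function.Injective (extToHom hsurj ε M) := by
  obtain ⟨n, q, hq⟩ := Module.Finite.exists_fin' R M
  have h := (IsShortExact.of_ker hq).restrictScalars (S := S)
  have hpre : Function.Injective (pre C g (q.restrictScalars S)) := by
    match g with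
    | 0 => exact h.pre_injective_zero C
    | g + 1 =>
      exact injective_of_exact (h.pre_exact₃ C g) (ext_subsingleton_of_lt hR g.lt_succ_self _)
  intro ξ ξ' hξ
  apply hpre
  apply (extToHom_pi_bijective hsurj ε n).1
  rw [extToHom_pre, extToHom_pre, hξ]

lemma extToHom_bijective (hR : ∀ j < g, Subsingleton (ExtM S R C j))
    (M : Type u) [AddCommGroup M] [Module S M] [Module R M]
    [IsScalarTower S R M] [Module.Finite R M] : Function.Bijective (extToHom hsurj ε M) := by
  refine ⟨extToHom_injective hsurj ε hR M, fun f ↦ ?_⟩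
  obtain ⟨n, q, hq⟩ := Module.Finite.exists_fin' R M
  have h := IsShortExact.of_ker hq
  obtain ⟨ξ, hξ⟩ := (extToHom_pi_bijective hsurj ε n).2 (f ∘ₗ q)
  have h0 : pre C g ((LinearMap.ker q).subtype.restrictScalars S) ξ = 0 := by
    apply extToHom_injective hsurj ε hR
    rw [extToHom_pre, hξ, LinearMap.comp_assoc, h.exact.linearMap_comp_eq_zero,
      LinearMap.comp_zero, map_zero]
  obtain ⟨ξ', rfl⟩ := (h.restrictScalars.pre_exact₂ C g ξ).mp h0
  rw [extToHom_pre] at hξ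
  exact ⟨ξ', (LinearMap.cancel_right hq).mp hξ⟩

lemma preδ_eq_zero_iff_preδ_extToHom_eq_zero (hR : ∀ j < g, Subsingleton (ExtM S R C j))
    [Module.Finite R M] [Module.Finite R M'] {f : M →ₗ[R] M'} {q : M' →ₗ[R] M''}
    (h : IsShortExact f q) (ξ : ExtM S M C g) :
    (h.restrictScalars (S := S)).preδ C g ξ = 0 ↔
      h.preδ W 0 (zeroEquiv.symm (extToHom hsurj ε M ξ)) = 0 := by
  rw [h.restrictScalars.pre_exact₁ C g ξ, h.pre_exact₁ W 0 _]
  constructor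
  · rintro ⟨η, rfl⟩
    exact ⟨zeroEquiv.symm (extToHom hsurj ε M' η), by rw [pre_zeroEquiv_symm, extToHom_pre]⟩
  · rintro ⟨a, ha⟩
    obtain ⟨a, rfl⟩ := zeroEquiv.symm.surjective a
    obtain ⟨η, rfl⟩ := (extToHom_bijective hsurj ε hR M').2 a
    rw [pre_zeroEquiv_symm, ← extToHom_pre, EmbeddingLike.apply_eq_iff_eq] at ha
    exact ⟨η, extToHom_injective hsurj ε hR M ha⟩

include hsurj ε in
theorem exists_ext_bijective (hR : ∀ j, j ≠ g → Subsingleton (ExtM S R C j)) (i : ℕ) :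
    ∀ (M : Type u) [AddCommGroup M] [Module S M] [Module R M] [IsScalarTower S R M]
      [Module.Finite R M], ∃ f : ExtM S M C (g + i) →ₛₗ[algebraMap S R] ExtM R M W i,
        Function.Bijective f := by
  have hR' (j : ℕ) (hj : j < g) := hR j hj.ne
  have bijective_zero (M : Type u) [AddCommGroup M] [Module S M] [Module R M]
      [IsScalarTower S R M] [Module.Finite R M] :
      Function.Bijective ((zeroEquiv (N := W)).symm.toLinearMap.comp (extToHom hsurj ε M)) :=
    zeroEquiv.symm.bijective.comp (extToHom_bijective hsurj ε hR' M)
  induction i with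
  | zero => exact fun M _ _ _ _ _ ↦ ⟨_, bijective_zero M⟩
  | succ i ih =>
    intro M _ _ _ _ _
    obtain ⟨n, q, hq⟩ := Module.Finite.exists_fin' R M
    have h := IsShortExact.of_ker hq
    have hS (i : ℕ) := ext_pi_subsingleton (hR (g + (i + 1)) (by omega)) n
    have hδS := surjective_of_exact (h.restrictScalars.pre_exact₃ C (g + i)) (hS i)
    have hδR := surjective_of_exact (h.pre_exact₃ W i) (subsingleton_of_projective i)
    match i with
    | 0 =>
      exact exists_bijective_of_ker_iff hδS hδR (bijective_zero _).2
        (preδ_eq_zero_iff_preδ_extToHom_eq_zero hsurj ε hR' h)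
    | i + 1 =>
      obtain ⟨f, hf⟩ := ih (LinearMap.ker q)
      refine exists_bijective_of_ker_iff hδS hδR hf.2 fun b ↦ ?_
      rw [map_eq_zero_iff _ (injective_of_exact (h.restrictScalars.pre_exact₁ C (g + (i + 1)))
          (hS i)),
        map_eq_zero_iff _ (injective_of_exact (h.pre_exact₁ W (i + 1))
          (subsingleton_of_projective i)), map_eq_zero_iff f hf.1]

end ChangeOfRings

section Descent

open ExtM

lemma height_add_ringKrullDim_quotient_le {S : Type*} [CommRing S] {I : Ideal S} {g d n : ℕ}
    (hg : I.height = g) (hd : (d : WithBot ℕ∞) = ringKrullDim (S ⧸ I))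
    (hn : (n : WithBot ℕ∞) = ringKrullDim S) : g + d ≤ n := by
  rw [ringKrullDim_quotient] at hd
  obtain ⟨p, rfl⟩ := Order.le_krullDim_iff.mp hd.le
  have key (i : ℕ) (hi : i < p.length + 1) :
      ((g + i : ℕ) : ℕ∞) ≤ (p ⟨i, hi⟩).1.asIdeal.height := by
    induction i with
    | zero => exact (add_zero g).symm ▸ hg ▸ Ideal.height_mono (p ⟨0, hi⟩).2
    | succ i ih =>
      have hlt : (p ⟨i, by omega⟩).1.asIdeal < (p ⟨i + 1, hi⟩).1.asIdeal :=
        p.strictMono (Fin.mk_lt_mk.mpr i.lt_succ_self)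
      calc ((g + (i + 1) : ℕ) : ℕ∞) = (g + i : ℕ) + 1 := by push_cast; ring
        _ ≤ (p ⟨i, by omega⟩).1.asIdeal.height + 1 := by gcongr; exact ih _
        _ ≤ _ := Ideal.height_add_one_le_of_lt_of_isPrime hlt
  have hlast := (WithBot.coe_le_coe.mpr (key p.length (by omega))).trans
    Ideal.height_le_ringKrullDim_of_isPrime
  rw [← hn] at hlast
  exact_mod_cast hlast

lemma nonempty_residueField_equiv {S R : Type*} [CommRing S] [IsLocalRing S] [CommRing R]
    [IsLocalRing R] [Algebra S R] (hsurj : Function.Surjective (algebraMap S R)) :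
    Nonempty (ResidueField S ≃ₗ[S] ResidueField R) := by
  have hf : Function.Surjective (Algebra.linearMap S (ResidueField R)) := by
    rw [Algebra.coe_linearMap, IsScalarTower.algebraMap_eq S R (ResidueField R), RingHom.coe_comp]
    exact residue_surjective.comp hsurj
  have hker : LinearMap.ker (Algebra.linearMap S (ResidueField R)) = maximalIdeal S :=
    IsLocalRing.eq_maximalIdeal
      (RingHom.ker_isMaximal_of_surjective (algebraMap S (ResidueField R)) hf)
  exact ⟨(Submodule.quotEquivOfEq _ _ hker.symm).trans
    ((Algebra.linearMap S (ResidueField R)).quotKerEquivOfSurjective hf)⟩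

lemma nonempty_linearEquiv_of_semilinear_bijective {S R B B' D : Type*} [CommRing S] [CommRing R]
    [Algebra S R] [AddCommGroup B] [Module S B] [AddCommGroup B'] [Module R B'] [AddCommGroup D]
    [Module S D] [Module R D] [IsScalarTower S R D] (hsurj : Function.Surjective (algebraMap S R))
    {f : B →ₛₗ[algebraMap S R] B'} (hf : Function.Bijective f) (e : B ≃ₗ[S] D) :
    Nonempty (B' ≃ₗ[R] D) := by
  let F : B ≃+ B' := AddEquiv.ofBijective f hf
  refine ⟨(F.symm.trans e.toAddEquiv).toLinearEquiv fun r x ↦ ?_⟩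
  obtain ⟨s, rfl⟩ := hsurj r
  obtain ⟨b, rfl⟩ := F.surjective x
  have hF : algebraMap S R s • F b = F (s • b) := (map_smulₛₗ f s b).symm
  simp [hF]

namespace IsCanonicalModule

variable {S : Type u} [CommRing S] [IsLocalRing S] [IsNoetherianRing S] {I : Ideal S}
  {C : Type u} [AddCommGroup C] [Module S C] {g : ℕ}

lemma ext_quotient_subsingleton {d n : ℕ} (hC : IsCanonicalModule S C)
    (hn : (n : WithBot ℕ∞) = ringKrullDim S) (hd : (d : WithBot ℕ∞) = ringKrullDim (S ⧸ I))
    {i : ℕ} (hi : i + d < n) : Subsingleton (ExtM S (S ⧸ I) C i) := by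
  have := hC.finite
  refine ext_subsingleton_of_residueField fun j hj ↦ hC.ext_subsingleton hn ?_
  rw [Module.supportDim_quotient_eq_ringKrullDim, ← hd] at hj
  have : j ≤ d := by exact_mod_cast hj
  omega

variable [IsLocalRing (S ⧸ I)] {W : Type u} [AddCommGroup W] [Module S W] [Module (S ⧸ I) W]
  [IsScalarTower S (S ⧸ I) W]

lemma exists_ext_residueField_bijective (hC : IsCanonicalModule S C) (hg : I.height = g)
    (hgt : ∀ j, g < j → Subsingleton (ExtM S (S ⧸ I) C j)) (ε : ExtM S (S ⧸ I) C g ≃ₗ[S] W)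
    (i : ℕ) : ∃ f : ExtM S (ResidueField S) C (g + i) →ₛₗ[algebraMap S (S ⧸ I)]
      ExtM (S ⧸ I) (ResidueField (S ⧸ I)) W i, Function.Bijective f := by
  obtain ⟨n, hn⟩ := exists_natCast_eq_ringKrullDim S
  obtain ⟨d, hd⟩ := exists_natCast_eq_ringKrullDim (S ⧸ I)
  have hle := height_add_ringKrullDim_quotient_le hg hd hn
  obtain ⟨ρ⟩ := nonempty_residueField_equiv (S := S) (R := S ⧸ I) Ideal.Quotient.mk_surjective
  obtain ⟨f, hf⟩ := exists_ext_bijective Ideal.Quotient.mk_surjective ε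
    (fun j hj ↦ hj.lt_or_gt.elim (fun h ↦ hC.ext_quotient_subsingleton hn hd (by omega)) (hgt j))
    i (ResidueField (S ⧸ I))
  exact ⟨f.comp (congrLeft ρ C (g + i)).toLinearMap, hf.comp (LinearEquiv.bijective _)⟩

lemma ringKrullDim_eq_height_add {d n : ℕ} (hC : IsCanonicalModule S C)
    (hn : (n : WithBot ℕ∞) = ringKrullDim S) (hd : (d : WithBot ℕ∞) = ringKrullDim (S ⧸ I))
    (hg : I.height = g) (hgt : ∀ j, g < j → Subsingleton (ExtM S (S ⧸ I) C j))
    (ε : ExtM S (S ⧸ I) C g ≃ₗ[S] W) : n = g + d := by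
  refine le_antisymm ?_ (height_add_ringKrullDim_quotient_le hg hd hn)
  by_contra! hlt
  have := hC.ext_quotient_subsingleton hn hd hlt
  have hW : Subsingleton W := ε.symm.toEquiv.subsingleton
  obtain ⟨m, rfl⟩ := Nat.exists_eq_add_of_le (show g ≤ n by omega)
  obtain ⟨f, hf⟩ := hC.exists_ext_residueField_bijective hg hgt ε m
  have := hC.ext_nontrivial hn
  have := subsingleton_of_subsingleton_right (A := S ⧸ I) (M := ResidueField (S ⧸ I)) (N := W) m
  exact not_subsingleton _ hf.1.subsingleton

theorem of_ext_linearEquiv (hC : IsCanonicalModule S C) [Module.Finite (S ⧸ I) W]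
    (hg : I.height = g) (hgt : ∀ j, g < j → Subsingleton (ExtM S (S ⧸ I) C j))
    (ε : ExtM S (S ⧸ I) C g ≃ₗ[S] W) : IsCanonicalModule (S ⧸ I) W := by
  obtain ⟨n, hn⟩ := exists_natCast_eq_ringKrullDim S
  obtain ⟨d, hd⟩ := exists_natCast_eq_ringKrullDim (S ⧸ I)
  obtain rfl := hC.ringKrullDim_eq_height_add hn hd hg hgt ε
  have key := hC.exists_ext_residueField_bijective hg hgt ε
  refine ⟨inferInstance, fun i hi ↦ ?_, fun i hi ↦ ?_⟩
  · obtain ⟨f, hf⟩ := key i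
    have := hC.ext_subsingleton hn (i := g + i) fun h ↦ hi (by rw [← hd, Nat.add_left_cancel h])
    exact hf.2.subsingleton
  · obtain rfl : i = d := by exact_mod_cast hi.trans hd.symm
    obtain ⟨f, hf⟩ := key i
    obtain ⟨e⟩ := hC.ext_dim (g + i) hn
    obtain ⟨ρ⟩ := nonempty_residueField_equiv (S := S) (R := S ⧸ I) Ideal.Quotient.mk_surjective
    exact nonempty_linearEquiv_of_semilinear_bijective Ideal.Quotient.mk_surjective hf (e.trans ρ)

end IsCanonicalModule

end Descent

section MinimalPrimes

lemma one_le_height_iff_forall_minimalPrimes {R : Type*} [CommRing R] (I : Ideal R) :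
    1 ≤ I.height ↔ ∀ P ∈ minimalPrimes R, ¬ I ≤ P := by
  rw [Order.one_le_iff_ne_zero]
  refine ⟨fun h P hP hle ↦ ?_, fun h h0 ↦ ?_⟩
  · have := hP.isPrime
    refine h (le_antisymm ?_ bot_le)
    exact (Ideal.height_mono hle).trans (Ideal.height_eq_zero_iff.mpr hP).le
  · rw [Ideal.height_eq_inf_minimalPrimes] at h0
    simp only [ENat.iInf_eq_zero] at h0
    obtain ⟨P, hP, h0⟩ := h0
    have := hP.isPrime
    exact h P (Ideal.height_eq_zero_iff.mp h0) hP.le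

theorem IsCanonicalModule.associatedPrimes_subset_minimalPrimes {A ω : Type u} [CommRing A]
    [IsLocalRing A] [IsNoetherianRing A] [AddCommGroup ω] [Module A ω]
    (hω : IsCanonicalModule A ω) : associatedPrimes A ω ⊆ minimalPrimes A := by
  intro P hP
  have : P.IsPrime := hP.isPrime
  have : IsLocalRing (A ⧸ P) := .of_surjective' _ Ideal.Quotient.mk_surjective
  obtain ⟨n, hn⟩ := exists_natCast_eq_ringKrullDim A
  obtain ⟨d, hd⟩ := exists_natCast_eq_ringKrullDim (A ⧸ P)
  obtain ⟨-, f, hf⟩ := (isAssociatedPrime_iff_exists_injective_linearMap P ω).mp hP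
  have hnd : n ≤ d := by
    by_contra! hlt
    have := hω.ext_quotient_subsingleton (i := 0) hn hd (by omega)
    have hf0 : f = 0 := ExtM.zeroEquiv.symm.injective (Subsingleton.elim _ _)
    exact one_ne_zero (hf ((LinearMap.congr_fun hf0 1).trans (map_zero f).symm))
  obtain ⟨h, hh⟩ := ENat.ne_top_iff_exists.mp (Ideal.height_ne_top (I := P) hP.isPrime.ne_top)
  have := height_add_ringKrullDim_quotient_le hh.symm hd hn
  exact Ideal.height_eq_zero_iff.mp (hh.symm.trans (by norm_cast; omega))

end MinimalPrimes

section Minors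

lemma exists_linearIndependent_col_submatrix {K m n : Type*} [Field K] [Finite m] [Fintype n]
    {r : ℕ} (D : Matrix m n K) (hr : r ≤ D.rank) :
    ∃ b : Fin r → n, LinearIndependent K (D.submatrix id b).col := by
  rw [Matrix.rank_eq_finrank_span_cols] at hr
  obtain ⟨f, hf, -, hli⟩ := Submodule.exists_fun_fin_finrank_span_eq K (Set.range D.col)
  choose b hb using hf
  refine ⟨b ∘ Fin.castLE hr, ?_⟩
  have hcol : (D.submatrix id (b ∘ Fin.castLE hr)).col = f ∘ Fin.castLE hr :=
    funext fun j ↦ hb (Fin.castLE hr j)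
  rw [hcol]
  exact hli.comp _ (Fin.castLE_injective hr)

lemma exists_det_submatrix_ne_zero {K m n : Type*} [Field K] [Finite m] [Fintype n] {r : ℕ}
    (D : Matrix m n K) (hr : r ≤ D.rank) :
    ∃ (a : Fin r → m) (b : Fin r → n), (D.submatrix a b).det ≠ 0 := by
  cases nonempty_fintype m
  obtain ⟨b, hb⟩ := exists_linearIndependent_col_submatrix D hr
  have hrank : r ≤ (D.submatrix id b).transpose.rank := by
    have hrow : LinearIndependent K (D.submatrix id b).transpose.row := hb
    rw [hrow.rank_matrix, Fintype.card_fin]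
  obtain ⟨a, ha⟩ := exists_linearIndependent_col_submatrix _ hrank
  change LinearIndependent K (D.submatrix a b).row at ha
  rw [Matrix.linearIndependent_rows_iff_isUnit, Matrix.isUnit_iff_isUnit_det] at ha
  exact ⟨a, b, ha.ne_zero⟩

lemma rank_add_le {K m n : Type*} [Field K] [Finite m] [Fintype n] (A B : Matrix m n K) :
    (A + B).rank ≤ A.rank + B.rank := by
  rw [Matrix.rank, Matrix.mulVecLin_add]
  exact (Submodule.finrank_mono (LinearMap.range_add_le _ _)).trans
    (Submodule.finrank_add_le_finrank_add_finrank _ _)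

variable {R : Type*} [CommRing R]

lemma mem_of_forall_single_mem {m : Type*} [Finite m] [DecidableEq m]
    {N : Submodule R (m → R)} {u : m → R} (h : ∀ i, u i ≠ 0 → Pi.single i 1 ∈ N) : u ∈ N := by
  cases nonempty_fintype m
  rw [pi_eq_sum_univ' u]
  refine sum_mem fun i _ ↦ ?_
  by_cases hi : u i = 0
  · simp [hi]
  · convert N.smul_mem (u i) (h i hi) using 2

lemma det_submatrix_smul_mem {m n r : Type*} [Finite m] [DecidableEq m] [Fintype n] [Fintype r]
    [DecidableEq r] (φ : Matrix m n R) {a : r → m} (ha : Function.Injective a)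
    (b : r → n) {N : Submodule R (m → R)} (hφ : LinearMap.range φ.mulVecLin ≤ N)
    (hN : ∀ i ∉ Set.range a, Pi.single i 1 ∈ N) (u : m → R) :
    (φ.submatrix a b).det • u ∈ N := by
  classical
  set δ := (φ.submatrix a b).det
  have hrow (j : r) : δ • Pi.single (a j) 1 ∈ N := by
    let v : n → R := ∑ k, (φ.submatrix a b).adjugate k j • Pi.single (b k) 1
    have hv (k : r) : φ.mulVec v (a k) = (δ • (1 : Matrix r r R)) k j := by
      rw [← Matrix.mul_adjugate, Matrix.mul_apply]
      simp [v, Matrix.mulVec_sum, Matrix.mulVec_smul, mul_comm]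
    rw [← sub_sub_cancel (φ.mulVec v) (δ • Pi.single (a j) 1)]
    refine sub_mem (hφ ⟨v, rfl⟩) (mem_of_forall_single_mem fun i hi ↦ hN i ?_)
    rintro ⟨k, rfl⟩
    refine hi ?_
    rw [Pi.sub_apply, hv]
    simp [Matrix.one_apply, Pi.single_apply, ha.eq_iff]
  refine mem_of_forall_single_mem (N := N.comap (δ • LinearMap.id)) fun i _ ↦ ?_
  by_cases hi : i ∈ Set.range a
  · obtain ⟨j, rfl⟩ := hi
    exact hrow j
  · exact N.smul_mem δ (hN i hi)

lemma compl_range_subsingleton {p : ℕ} {a : Fin (p - 1) → Fin p} (ha : Function.Injective a) :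
    (Set.range a)ᶜ.Subsingleton := by
  rw [← Set.ncard_le_one_iff_subsingleton, Set.ncard_compl, Set.ncard_range_of_injective ha]
  simp only [Nat.card_eq_fintype_card, Fintype.card_fin]
  omega

lemma injective_of_det_submatrix_ne_zero {m n r : Type*} [Fintype r] [DecidableEq r]
    {φ : Matrix m n R} {a : r → m} {b : r → n} (h : (φ.submatrix a b).det ≠ 0) :
    Function.Injective a := fun i j hij ↦
  by_contra fun hne ↦ h (Matrix.det_zero_of_row_eq hne (funext fun k ↦ by simp [hij]))

variable {p q : ℕ} (φ : Matrix (Fin p) (Fin q) R)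

theorem minorsIdeal_le_annihilator_coker :
    minorsIdeal φ p ≤ Module.annihilator R (Coker φ.mulVecLin) := by
  refine Ideal.span_le.mpr ?_
  rintro _ ⟨a, b, rfl⟩
  refine Module.mem_annihilator.mpr fun w ↦ ?_
  obtain ⟨u, rfl⟩ := Submodule.mkQ_surjective _ w
  by_cases h : (φ.submatrix a b).det = 0
  · rw [h, zero_smul]
  have ha := injective_of_det_submatrix_ne_zero h
  rw [← map_smul, Submodule.mkQ_apply, Submodule.Quotient.mk_eq_zero]
  exact det_submatrix_smul_mem φ ha b le_rfl
    (fun i hi ↦ (hi (Finite.surjective_of_injective ha i)).elim) u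

/-- The conductor `(R w :_R W)` of a module `W` into its cyclic submodule generated by `w`. For
`W` finitely generated, it is not contained in a prime ideal `P` if and only if `w` generates the
localization `W_P`. -/
def cyclicConductor {W : Type*} [AddCommGroup W] [Module R W] (w : W) : Ideal R :=
  (R ∙ w).colon Set.univ

lemma mem_cyclicConductor {W : Type*} [AddCommGroup W] [Module R W] {w : W} {r : R} :
    r ∈ cyclicConductor w ↔ ∀ x : W, r • x ∈ R ∙ w := by
  simp [cyclicConductor, Submodule.mem_colon]

lemma exists_det_submatrix_mem_cyclicConductor {a : Fin (p - 1) → Fin p}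
    (ha : Function.Injective a) (b : Fin (p - 1) → Fin q) :
    ∃ w : Coker φ.mulVecLin, (φ.submatrix a b).det ∈ cyclicConductor w := by
  obtain ⟨v, hv⟩ : ∃ v : Fin p → R, ∀ i ∉ Set.range a, v = Pi.single i 1 := by
    rcases (compl_range_subsingleton ha).eq_empty_or_singleton with h | ⟨i, h⟩
    · exact ⟨0, fun i hi ↦ (Set.eq_empty_iff_forall_notMem.mp h i hi).elim⟩
    · exact ⟨Pi.single i 1, fun j hj ↦ by rw [(Set.eq_singleton_iff_unique_mem.mp h).2 j hj]⟩
  refine ⟨Submodule.mkQ _ v, mem_cyclicConductor.mpr fun x ↦ ?_⟩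
  obtain ⟨u, rfl⟩ := Submodule.mkQ_surjective _ x
  rw [← map_smul, ← Submodule.mem_comap]
  refine det_submatrix_smul_mem φ ha b ?_ (fun i hi ↦ ?_) u
  · exact (Submodule.ker_mkQ _).ge.trans (LinearMap.ker_le_comap _)
  · rw [← hv i hi]
    exact Submodule.mem_span_singleton_self _

lemma exists_smul_one_eq_mul_add_vecMulVec {c : Fin p → R} {x : R}
    (hx : x ∈ cyclicConductor (Submodule.mkQ (LinearMap.range φ.mulVecLin) c)) :
    ∃ (V : Matrix (Fin q) (Fin p) R) (a : Fin p → R),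
      x • (1 : Matrix (Fin p) (Fin p) R) = φ * V + Matrix.vecMulVec c a := by
  have h (j : Fin p) : ∃ (v : Fin q → R) (r : R), x • Pi.single j 1 = φ.mulVec v + r • c := by
    obtain ⟨r, hr⟩ := Submodule.mem_span_singleton.mp
      (mem_cyclicConductor.mp hx (Submodule.mkQ _ (Pi.single j 1)))
    rw [← map_smul, ← map_smul, eq_comm, ← sub_eq_zero, ← map_sub, Submodule.mkQ_apply,
      Submodule.Quotient.mk_eq_zero] at hr
    obtain ⟨v, hv⟩ := hr
    exact ⟨v, r, sub_eq_iff_eq_add.mp hv.symm⟩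
  choose v r h using h
  refine ⟨Matrix.of fun k j ↦ v j k, r, Matrix.ext fun i j ↦ ?_⟩
  have hij := congrFun (h j) i
  simp only [Pi.smul_apply, Pi.single_apply, Pi.add_apply, Matrix.mulVec, dotProduct,
    smul_eq_mul] at hij
  simp [Matrix.one_apply, Matrix.mul_apply, Matrix.vecMulVec_apply, hij, mul_comm (c i)]

theorem not_minorsIdeal_le_iff_exists_not_cyclicConductor_le (P : Ideal R) [P.IsPrime] :
    ¬ minorsIdeal φ (p - 1) ≤ P ↔ ∃ w : Coker φ.mulVecLin, ¬ cyclicConductor w ≤ P := by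
  constructor
  · intro h
    obtain ⟨_, ⟨a, b, rfl⟩, hP⟩ := Set.not_subset.mp (mt Ideal.span_le.mpr h)
    obtain ⟨w, hw⟩ := exists_det_submatrix_mem_cyclicConductor φ
      (injective_of_det_submatrix_ne_zero fun h0 ↦ hP (h0 ▸ P.zero_mem)) b
    exact ⟨w, fun hle ↦ hP (hle hw)⟩
  · rintro ⟨w, hw⟩ hle
    obtain ⟨c, rfl⟩ := Submodule.mkQ_surjective _ w
    obtain ⟨x, hx, hxP⟩ := SetLike.not_le_iff_exists.mp hw
    obtain ⟨V, a, hV⟩ := exists_smul_one_eq_mul_add_vecMulVec φ hx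
    let ι := algebraMap R P.ResidueField
    have hVι : ι x • (1 : Matrix (Fin p) (Fin p) P.ResidueField) =
        φ.map ι * V.map ι + Matrix.vecMulVec (ι ∘ c) (ι ∘ a) := by
      have hmap : (Matrix.vecMulVec c a).map ι = Matrix.vecMulVec (ι ∘ c) (ι ∘ a) :=
        Matrix.ext fun i j ↦ map_mul ι (c i) (a j)
      simpa [Matrix.map_add, Matrix.map_mul, Matrix.smul_one_eq_diagonal, Matrix.diagonal_map,
        hmap] using congrArg (fun M ↦ M.map ι) hV
    have hιx : ι x ≠ 0 := mt Ideal.algebraMap_residueField_eq_zero.mp hxP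
    have hrank : p ≤ (φ.map ι).rank + 1 := calc
      p = (ι x • (1 : Matrix (Fin p) (Fin p) P.ResidueField)).rank := by
        rw [Matrix.rank_smul_of_mem_nonZeroDivisors _ (mem_nonZeroDivisors_of_ne_zero hιx),
          Matrix.rank_one, Fintype.card_fin]
      _ ≤ (φ.map ι * V.map ι).rank + (Matrix.vecMulVec (ι ∘ c) (ι ∘ a)).rank :=
        hVι ▸ rank_add_le _ _
      _ ≤ (φ.map ι).rank + 1 :=
        add_le_add (Matrix.rank_mul_le_left _ _) (Matrix.rank_vecMulVec_le _ _)
    obtain ⟨r, s, hrs⟩ := exists_det_submatrix_ne_zero (φ.map ι) (Nat.sub_le_of_le_add hrank)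
    refine hrs ?_
    rw [Matrix.submatrix_map, ← RingHom.mapMatrix_apply, ← RingHom.map_det,
      Ideal.algebraMap_residueField_eq_zero]
    exact hle (Ideal.subset_span ⟨r, s, rfl⟩)

end Minors

section IdealEmbedding

variable {R W : Type*} [CommRing R] [AddCommGroup W] [Module R W]

lemma mul_mem_cyclicConductor {w₀ w : W} {b c : R} (hb : b • w₀ ∈ R ∙ w)
    (hc : c ∈ cyclicConductor w₀) : b * c ∈ cyclicConductor w := by
  refine mem_cyclicConductor.mpr fun x ↦ ?_
  obtain ⟨r, hr⟩ := Submodule.mem_span_singleton.mp (mem_cyclicConductor.mp hc x)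
  rw [mul_smul, ← hr, smul_comm]
  exact Submodule.smul_mem _ r hb

lemma not_cyclicConductor_smul_add_le {P : Ideal R} [P.IsPrime] {w₀ v : W} {u : R}
    (hw₀ : ¬ cyclicConductor w₀ ≤ P) (hu : u ∉ P) (hv : v ∈ P • (⊤ : Submodule R W)) :
    ¬ cyclicConductor (u • w₀ + v) ≤ P := by
  obtain ⟨c, hc, hcP⟩ := SetLike.not_le_iff_exists.mp hw₀
  obtain ⟨a, haP, ha⟩ : ∃ a ∈ P, a • w₀ = c • v := by
    rw [← Submodule.mem_smul_span_singleton]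
    refine Submodule.smul_induction_on hv (fun a ha x _ ↦ ?_) fun x y hx hy ↦ ?_
    · rw [smul_comm]
      exact Submodule.smul_mem_smul ha (mem_cyclicConductor.mp hc x)
    · rw [smul_add]
      exact add_mem hx hy
  have hb : (c * u + a) • w₀ ∈ R ∙ (u • w₀ + v) :=
    Submodule.mem_span_singleton.mpr ⟨c, by rw [smul_add, ← ha, smul_smul, add_smul]⟩
  refine fun hle ↦ hcP ((‹P.IsPrime›.mem_or_mem (hle (mul_mem_cyclicConductor hb hc))).resolve_left
    fun h ↦ ?_)
  exact (‹P.IsPrime›.mem_or_mem ((Ideal.add_mem_iff_left P haP).mp h)).elim hcP hu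

lemma exists_notMem_forall_mem_of_isAntichain {s : Finset (Ideal R)}
    (hs : IsAntichain (· ≤ ·) (s : Set (Ideal R))) {P : Ideal R} [P.IsPrime] (hP : P ∈ s) :
    ∃ u ∉ P, ∀ Q ∈ s, Q ≠ P → u ∈ Q := by
  classical
  have h : ¬ (s.erase P).inf id ≤ P := by
    rw [Ideal.IsPrime.inf_le' ‹_›]
    rintro ⟨Q, hQ, hQP⟩
    exact hs (Finset.mem_of_mem_erase hQ) hP (Finset.ne_of_mem_erase hQ) hQP
  obtain ⟨u, hu, huP⟩ := SetLike.not_le_iff_exists.mp h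
  exact ⟨u, huP, fun Q hQ hne ↦
    (Finset.inf_le (f := id) (Finset.mem_erase.mpr ⟨hne, hQ⟩) : _ ≤ Q) hu⟩

lemma exists_forall_not_cyclicConductor_le {s : Finset (Ideal R)} (hprime : ∀ P ∈ s, P.IsPrime)
    (hs : IsAntichain (· ≤ ·) (s : Set (Ideal R)))
    (h : ∀ P ∈ s, ∃ w : W, ¬ cyclicConductor w ≤ P) :
    ∃ w : W, ∀ P ∈ s, ¬ cyclicConductor w ≤ P := by
  classical
  have hu (P : s) : ∃ u ∉ P.1, ∀ Q ∈ s, Q ≠ P.1 → u ∈ Q :=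
    have := hprime P P.2
    exists_notMem_forall_mem_of_isAntichain hs P.2
  choose u hu hmem using hu
  choose w hw using fun P : s ↦ h P P.2
  refine ⟨∑ P, u P • w P, fun P hP ↦ ?_⟩
  have := hprime P hP
  rw [← Finset.add_sum_erase _ _ (Finset.mem_univ ⟨P, hP⟩)]
  refine not_cyclicConductor_smul_add_le (hw ⟨P, hP⟩) (hu ⟨P, hP⟩) (sum_mem fun Q hQ ↦ ?_)
  exact Submodule.smul_mem_smul
    (hmem Q P hP fun heq ↦ Finset.ne_of_mem_erase hQ (Subtype.ext heq.symm)) trivial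

lemma map_mem_cyclicConductor_of_injective {f : W →ₗ[R] R} (hf : Function.Injective f) (w : W) :
    f w ∈ cyclicConductor w :=
  mem_cyclicConductor.mpr fun x ↦ Submodule.mem_span_singleton.mpr ⟨f x, hf (by
    rw [map_smul, map_smul, smul_eq_mul, smul_eq_mul, mul_comm])⟩

lemma exists_injective_of_mem_cyclicConductor {w : W} {s : R} (hs : s ∈ cyclicConductor w)
    (hreg : IsSMulRegular W s) (hW : Module.annihilator R W = ⊥) :
    ∃ f : W →ₗ[R] R, Function.Injective f := by
  have hw : LinearMap.ker (LinearMap.toSpanSingleton R W w) = ⊥ := by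
    rw [eq_bot_iff, ← hW]
    intro r hr
    refine Module.mem_annihilator.mpr fun x ↦ hreg ?_
    obtain ⟨a, ha⟩ := Submodule.mem_span_singleton.mp (mem_cyclicConductor.mp hs x)
    change r • w = 0 at hr
    change s • r • x = s • 0
    rw [smul_zero, smul_comm, ← ha, smul_comm, hr, smul_zero]
  let e : R ≃ₗ[R] R ∙ w := (LinearEquiv.ofInjective _ (LinearMap.ker_eq_bot.mp hw)).trans
    (LinearEquiv.ofEq _ _ (LinearMap.range_toSpanSingleton w))
  let m : W →ₗ[R] R ∙ w := (LinearMap.lsmul R W s).codRestrict _ (mem_cyclicConductor.mp hs)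
  exact ⟨e.symm.toLinearMap ∘ₗ m,
    e.symm.injective.comp fun x y hxy ↦ hreg (congrArg Subtype.val hxy)⟩

section Noetherian

variable [IsNoetherianRing R]

lemma not_range_le_of_mem_minimalPrimes {f : W →ₗ[R] R} (hf : Function.Injective f)
    (hW : Module.annihilator R W = ⊥) {P : Ideal R} (hP : P ∈ minimalPrimes R) :
    ¬ LinearMap.range f ≤ P := by
  intro hle
  have hass : IsAssociatedPrime P R := by
    refine Module.associatedPrimes.minimalPrimes_annihilator_subset_associatedPrimes R R ?_
    rwa [Module.annihilator_eq_bot.mpr inferInstance]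
  obtain ⟨hprime, r, rfl⟩ := isAssociatedPrime_iff.mp hass
  have hr : r ∈ Module.annihilator R W := Module.mem_annihilator.mpr fun x ↦ hf <| by
    rw [map_smul, map_zero, smul_eq_mul, mul_comm]
    simpa [Submodule.mem_colon_singleton] using hle ⟨x, rfl⟩
  rw [hW, Submodule.mem_bot] at hr
  exact hprime.ne_top (by simp [hr])

lemma exists_isSMulRegular_mem [Module.Finite R W] {I : Ideal R}
    (hI : ∀ P ∈ associatedPrimes R W, ¬ I ≤ P) : ∃ s ∈ I, IsSMulRegular W s := by
  by_contra! h
  have hsub : (I : Set R) ⊆ ⋃ P ∈ associatedPrimes R W, (P : Set R) := fun s hs ↦ by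
    rw [biUnion_associatedPrimes_eq_compl_regular]
    exact h s hs
  obtain ⟨P, hP, hle⟩ := (Ideal.subset_union_prime_finite (associatedPrimes.finite R W) 0 0
    fun P hP _ _ ↦ hP.isPrime).mp hsub
  exact hI P hP hle

theorem exists_linearEquiv_ideal_iff_exists_not_cyclicConductor_le [Module.Finite R W]
    (hann : Module.annihilator R W = ⊥) (hass : associatedPrimes R W ⊆ minimalPrimes R) :
    (∃ J : Ideal R, Nonempty (W ≃ₗ[R] J)) ↔
      ∀ P ∈ minimalPrimes R, ∃ w : W, ¬ cyclicConductor w ≤ P := by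
  constructor
  · rintro ⟨J, ⟨e⟩⟩ P hP
    have hf : Function.Injective (J.subtype ∘ₗ e.toLinearMap) :=
      J.subtype_injective.comp e.injective
    obtain ⟨_, ⟨w, rfl⟩, hw⟩ :=
      SetLike.not_le_iff_exists.mp (not_range_le_of_mem_minimalPrimes hf hann hP)
    exact ⟨w, fun hle ↦ hw (hle (map_mem_cyclicConductor_of_injective hf w))⟩
  · intro h
    have hfin : (minimalPrimes R).Finite := minimalPrimes.finite_of_isNoetherianRing R
    obtain ⟨w, hw⟩ := exists_forall_not_cyclicConductor_le (s := hfin.toFinset)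
      (by simpa using fun P (hP : P ∈ minimalPrimes R) ↦ hP.isPrime)
      (by rw [hfin.coe_toFinset]; exact setOfPred_minimal_antichain _) (by simpa using h)
    simp only [Set.Finite.mem_toFinset] at hw
    obtain ⟨s, hs, hreg⟩ := exists_isSMulRegular_mem fun P hP ↦ hw P (hass hP)
    obtain ⟨f, hf⟩ := exists_injective_of_mem_cyclicConductor hs hreg hann
    exact ⟨LinearMap.range f, ⟨LinearEquiv.ofInjective f hf⟩⟩

end Noetherian

end IdealEmbedding

section AuslanderDual

variable {R : Type*} [CommRing R] {p q : ℕ} (φ : Matrix (Fin p) (Fin q) R)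

lemma nonempty_auslanderDual_equiv_coker_transpose :
    Nonempty (AuslanderDual φ.mulVecLin ≃ₗ[R] Coker φ.transpose.mulVecLin) := by
  refine ⟨(Submodule.Quotient.equiv _ _ (dotProductEquiv R (Fin q)) ?_).symm⟩
  have hcomp : (dotProductEquiv R (Fin q)).toLinearMap ∘ₗ φ.transpose.mulVecLin =
      φ.mulVecLin.dualMap ∘ₗ (dotProductEquiv R (Fin p)).toLinearMap :=
    LinearMap.ext fun v ↦ (dotProductEquiv_comp_mulVecLin φ v).symm
  rw [← LinearMap.range_comp, hcomp, LinearMap.range_comp, LinearEquiv.range, Submodule.map_top]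

end AuslanderDual

theorem IsCanonicalModule.exists_linearEquiv_ideal_iff {R : Type u} [CommRing R] [IsLocalRing R]
    [IsNoetherianRing R] {p q : ℕ} {φ : Matrix (Fin p) (Fin q) R}
    (hφ : IsCanonicalModule R (Coker φ.mulVecLin)) :
    (∃ J : Ideal R, Nonempty (Coker φ.mulVecLin ≃ₗ[R] J)) ↔
      1 ≤ (minorsIdeal φ (p - 1)).height ∧ minorsIdeal φ p = ⊥ := by
  have := hφ.finite
  have hp : minorsIdeal φ p = ⊥ :=
    le_bot_iff.mp ((minorsIdeal_le_annihilator_coker φ).trans hφ.annihilator_eq_bot.le)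
  rw [exists_linearEquiv_ideal_iff_exists_not_cyclicConductor_le hφ.annihilator_eq_bot
    hφ.associatedPrimes_subset_minimalPrimes, and_iff_left hp,
    one_le_height_iff_forall_minimalPrimes]
  refine forall₂_congr fun P hP ↦ ?_
  have := hP.isPrime
  exact (not_minorsIdeal_le_iff_exists_not_cyclicConductor_le φ P).symm

theorem proposition3p5_general {S : Type u} [CommRing S] [IsLocalRing S] [IsNoetherianRing S]
    (hS : IsCanonicalModule S S) (I : Ideal S) [IsLocalRing (S ⧸ I)] (g : ℕ) (hg : I.height = g)
    (hCM : IsCohenMacaulayLocal (S ⧸ I)) (G : MinimalFreeResolution I g) :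
    IsCanonicalModule (S ⧸ I) (Coker G.lastMapTransposeQuot.mulVecLin) ∧
    ∀ (ω : Type u) [AddCommGroup ω] [Module (S ⧸ I) ω], IsCanonicalModule (S ⧸ I) ω →
      Nonempty (ω ≃ₗ[S ⧸ I] Coker G.lastMapTransposeQuot.mulVecLin) ∧
      (∃ π : (Fin (G.rank g) → S ⧸ I) →ₗ[S ⧸ I] ω,
        IsFreePresentation G.lastMapTransposeQuot.mulVecLin π ∧
        Nonempty (AuslanderDual G.lastMapTransposeQuot.mulVecLin ≃ₗ[S ⧸ I]
          Coker G.lastMapQuot.mulVecLin)) ∧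
      ((∃ J : Ideal (S ⧸ I), Nonempty (ω ≃ₗ[S ⧸ I] J)) ↔
        1 ≤ (minorsIdeal G.lastMapTransposeQuot (G.rank g - 1)).height ∧
          minorsIdeal G.lastMapTransposeQuot (G.rank g) = ⊥) := by
  obtain ⟨ε⟩ := G.nonempty_ext_quotient_equiv_coker
  have hC := hS.of_ext_linearEquiv hg (fun _ hj ↦ G.ext_quotient_subsingleton S hj) ε
  refine ⟨hC, fun ω _ _ hω ↦ ?_⟩
  obtain ⟨e⟩ := hC.nonempty_linearEquiv hCM hω
  refine ⟨⟨e⟩, ⟨e.symm.toLinearMap ∘ₗ Submodule.mkQ _, ?_,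
    nonempty_auslanderDual_equiv_coker_transpose _⟩, ?_⟩
  · exact
      { free₁ := inferInstance
        finite₁ := inferInstance
        free₀ := inferInstance
        finite₀ := inferInstance
        surjective := e.symm.surjective.comp (Submodule.mkQ_surjective _)
        exact := (LinearMap.exact_map_mkQ_range _).comp_injective _ e.symm.injective
          (map_zero e.symm) }
  · rw [← hC.exists_linearEquiv_ideal_iff]
    exact exists_congr fun J ↦ ⟨fun ⟨f⟩ ↦ ⟨e.symm.trans f⟩, fun ⟨f⟩ ↦ ⟨e.trans f⟩⟩

theorem proposition3p5 {S : Type u} [CommRing S] [IsRegularLocalRing S]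
    (I : Ideal S) [IsLocalRing (S ⧸ I)] (g : ℕ) (hg : I.height = g)
    (hCM : IsCohenMacaulayLocal (S ⧸ I)) (G : MinimalFreeResolution I g) :
    IsCanonicalModule (S ⧸ I) (Coker G.lastMapTransposeQuot.mulVecLin) ∧
    ∀ (ω : Type u) [AddCommGroup ω] [Module (S ⧸ I) ω], IsCanonicalModule (S ⧸ I) ω →
      Nonempty (ω ≃ₗ[S ⧸ I] Coker G.lastMapTransposeQuot.mulVecLin) ∧
      (∃ π : (Fin (G.rank g) → S ⧸ I) →ₗ[S ⧸ I] ω,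
        IsFreePresentation G.lastMapTransposeQuot.mulVecLin π ∧
        Nonempty (AuslanderDual G.lastMapTransposeQuot.mulVecLin ≃ₗ[S ⧸ I]
          Coker G.lastMapQuot.mulVecLin)) ∧
      ((∃ J : Ideal (S ⧸ I), Nonempty (ω ≃ₗ[S ⧸ I] J)) ↔
        1 ≤ (minorsIdeal G.lastMapTransposeQuot (G.rank g - 1)).height ∧
          minorsIdeal G.lastMapTransposeQuot (G.rank g) = ⊥) :=
  proposition3p5_general (isCanonicalModule_self_of_isRegularLocalRing S) I g hg hCM G
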